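/- **Conventions.** An affine variety $X$ over $\mathbb R$ is reduced and irreducible, that is, its coordinate ring $\mathbb R[X]$ is a finitely generated $\mathbb R$-algebra which is an integral domain; its points are its real points. The smooth locus $X_{\mathrm{reg}}$ is the set of (real) points $x$ of $X$ at which $\dim_{\mathbb R} T_xX=\dim X$, with its Euclidean topology. A one-parameter unipotent subgroup of $\mathrm{Aut}(X)$ is the subgroup defined by an effective algebraic action of the additive group $G_a(\mathbb R)$ on $X$, and $\mathrm{SAut}(X)\subseteq\mathrm{Aut}(X)$ is the subgroup generated by all one-parameter unipotent subgroups. A point $x\in X$ is flexible if $T_xX$ is spanned by the tangent vectors at $x$ to the orbits $H.x$ of one-parameter unipotent subgroups $H\subseteq \mathrm{Aut}(X)$, and $X$ is flexible if every point of $X_{\mathrm{reg}}$ is flexible. The group $\mathrm{SAut}(X)$ acts $m$-transitively on $X_{\mathrm{reg}}$ if for any two $m$-tuples $(a_1,\dots,a_m)$, $(b_1,\dots,b_m)$ of pairwise distinct points of $X_{\mathrm{reg}}$ there is $g\in\mathrm{SAut}(X)$ with $g(a_j)=b_j$ for $j=1,\dots,m$. The suspension over $X$ with a non-constant function $f\in\mathbb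 R[X]$ is the affine variety $$\mathrm{Susp}(X,f)=\{uv-f(x)=0\}\subseteq X\times\mathbb A^2,\qquad \mathbb A^2=\operatorname{Spec}\mathbb R[u,v].$$ **Theorem.** Let $X^{(0)}$ be a flexible affine real algebraic variety. Suppose that the smooth locus $X^{(0)}_{\mathrm{reg}}$ is connected and that $\mathrm{SAut}(X^{(0)})$ acts $m$-transitively on $X^{(0)}_{\mathrm{reg}}$ for every $m\in\mathbb N$. Consider iterated suspensions $X^{(i)}=\mathrm{Susp}(X^{(i-1)},f_i)$, $i=1,\dots,l$, where the functions $f_i\in\mathbb R[X^{(i-1)}]$ satisfy $f_i\bigl(X^{(i-1)}_{\mathrm{reg}}\bigr)=\mathbb R$ for $i=1,\dots,l$. Then for every $i=1,\dots,l$ the variety $X^{(i)}$ is flexible and $\mathrm{SAut}(X^{(i)})$ acts $m$-transitively on $X^{(i)}_{\mathrm{reg}}$ for every $m\in\mathbb N$. -/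

import Mathlib

open Polynomial

universe u

/-! An affine variety `X` over `ℝ` is represented by its coordinate ring `A = ℝ[X]`, a finitely
generated `ℝ`-algebra that is an integral domain. -/

/-- The real points of the affine variety with coordinate ring `A`: evaluating regular functions
at a point identifies the points with the `ℝ`-algebra homomorphisms `A → ℝ`. -/
def RealPoints (A : Type u) [CommRing A] [Algebra ℝ A] : Type u := A →ₐ[ℝ] ℝ

namespace RealPoints

variable {A : Type u} [CommRing A] [Algebra ℝ A]

/-- The value `a(x)` of the regular function `a ∈ A` at the point `x`, as a homomorphism in `a`. -/
def ev (x : RealPoints A) : A →ₐ[ℝ] ℝ := x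

/-- The Euclidean topology: the coarsest topology for which every regular function is continuous.
For any choice of generators `a₁, …, aₙ` of `A` it is the topology induced from `ℝⁿ` by
`x ↦ (a₁(x), …, aₙ(x))`. -/
instance : TopologicalSpace (RealPoints A) :=
  TopologicalSpace.induced (fun x a => x.ev a) (inferInstance : TopologicalSpace (A → ℝ))

/-- The group `Aut(X)`, realised as the group of `ℝ`-algebra automorphisms of `A`, acts on the
points of `X`: the automorphism `g` sends `x` to the point at which a function `a` takes the value
`(g⁻¹ a)(x)`. -/
instance : MulAction (A ≃ₐ[ℝ] A) (RealPoints A) where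
  smul g x := x.ev.comp (g⁻¹ : A ≃ₐ[ℝ] A).toAlgHom
  one_smul _ := rfl
  mul_smul g h x := by
    change x.ev.comp ((g * h)⁻¹ : A ≃ₐ[ℝ] A).toAlgHom =
      (x.ev.comp (h⁻¹ : A ≃ₐ[ℝ] A).toAlgHom).comp (g⁻¹ : A ≃ₐ[ℝ] A).toAlgHom
    rw [mul_inv_rev]
    rfl

/-- The Zariski tangent space `T_x X`: the point derivations of `A` at `x`. -/
def tangentSpace (x : RealPoints A) : Submodule ℝ (A →ₗ[ℝ] ℝ) where
  carrier := {D | ∀ a b : A, D (a * b) = x.ev a * D b + x.ev b * D a}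
  zero_mem' := by intro a b; simp
  add_mem' := by
    intro D E hD hE a b
    simp only [LinearMap.add_apply, hD a b, hE a b]
    ring
  smul_mem' := by
    intro c D hD a b
    simp only [LinearMap.smul_apply, smul_eq_mul, hD a b]
    ring

/-- `x` is a smooth point of the variety: `dim T_x X = dim X`. -/
def IsRegular (x : RealPoints A) : Prop :=
  (Module.finrank ℝ x.tangentSpace : WithBot ℕ∞) = ringKrullDim A

end RealPoints

/-- The smooth locus `X_reg` (of the real points). -/
def regularLocus (A : Type u) [CommRing A] [Algebra ℝ A] : Set (RealPoints A) :=
  {x | x.IsRegular}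

/-- An effective action of the additive group `G_a(ℝ)` on `X`: an injective homomorphism
`t ↦ φ_t` from `(ℝ, +)` to `Aut(X)` which is algebraic, that is, for every regular function `a` the
function `φ_t a` depends polynomially on `t`. -/
structure GaAction (A : Type u) [CommRing A] [Algebra ℝ A] where
  toHom : Multiplicative ℝ →* (A ≃ₐ[ℝ] A)
  effective : Function.Injective toHom
  algebraic : ∀ a : A, ∃ p : A[X], ∀ t : ℝ,
    toHom (Multiplicative.ofAdd t) a = p.eval (algebraMap ℝ A t)

/-- The one-parameter unipotent subgroup of `Aut(X)` defined by an effective `G_a`-action. -/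
def GaAction.subgroup {A : Type u} [CommRing A] [Algebra ℝ A] (φ : GaAction A) :
    Subgroup (A ≃ₐ[ℝ] A) :=
  φ.toHom.range

/-- The special automorphism group: the subgroup of `Aut(X)` generated by all its one-parameter
unipotent subgroups. -/
def SAut (A : Type u) [CommRing A] [Algebra ℝ A] : Subgroup (A ≃ₐ[ℝ] A) :=
  ⨆ φ : GaAction A, φ.subgroup

/-- The velocities at `t = 0` of the orbit maps `t ↦ φ_t • x`, for all effective `G_a`-actions
`φ` on `X`; they are the tangent vectors at `x` to the orbits of one-parameter unipotent
subgroups. -/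
def orbitVelocities {A : Type u} [CommRing A] [Algebra ℝ A] (x : RealPoints A) :
    Set (A →ₗ[ℝ] ℝ) :=
  {D | ∃ φ : GaAction A, ∀ a : A,
    HasDerivAt (fun t : ℝ => (φ.toHom (Multiplicative.ofAdd t) • x).ev a) (D a) 0}

/-- `x` is a flexible point: `T_x X` is spanned by the tangent vectors at `x` to the orbits of
one-parameter unipotent subgroups. -/
def IsFlexiblePoint {A : Type u} [CommRing A] [Algebra ℝ A] (x : RealPoints A) : Prop :=
  Submodule.span ℝ (orbitVelocities x) = x.tangentSpace

/-- The variety with coordinate ring `A` is flexible: every smooth point is. -/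
def IsFlexible (A : Type u) [CommRing A] [Algebra ℝ A] : Prop :=
  ∀ x ∈ regularLocus A, IsFlexiblePoint x

/-- The action of `SAut(X)` on `X_reg` is `m`-transitive: any `m`-tuple of pairwise distinct points
of `X_reg` can be sent to any other one. -/
def SAutIsMTransitive (A : Type u) [CommRing A] [Algebra ℝ A] (m : ℕ) : Prop :=
  ∀ a b : Fin m → RealPoints A, Function.Injective a → Function.Injective b →
    (∀ i, a i ∈ regularLocus A) → (∀ i, b i ∈ regularLocus A) →
    ∃ g ∈ SAut A, ∀ i, g • a i = b i

/-- The coordinate ring `A[u, v] / (u v - f)` of the suspension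
`Susp(X, f) = {u v - f(x) = 0} ⊆ X × 𝔸²`, where `u` and `v` are the variables `0` and `1`. -/
abbrev Suspension (A : Type u) [CommRing A] (f : A) : Type u :=
  MvPolynomial (Fin 2) A ⧸
    Ideal.span {(MvPolynomial.X 0 * MvPolynomial.X 1 - MvPolynomial.C f : MvPolynomial (Fin 2) A)}

/-!
The special automorphism group of an iterated suspension is infinitely transitive on the smooth
locus, and the suspension is flexible. By induction it is enough to treat one suspension
`Y = {uv = f(x)}` over `X`, given by an isomorphism `e : B ≃ₐ[ℝ] Suspension A f`.

*Smooth points.* The dimension of `Y` is `dim X + 1` (`Suspension.ringKrullDim_eq`), and the tangent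
space at a point over `x` is cut out of `T_x X × ℝ²` by `u dv + v du = df`. Hence the smooth points
are those over smooth points of `X` at which `u`, `v` and `df` do not all vanish
(`Suspension.mem_regularLocus_iff`). The case `u = v = 0`, `df = 0` is excluded because
`dim T_x X ≥ dim X` at every point (`RealPoints.ringKrullDim_le_finrank_tangentSpace`): the generic
rank of the module of differentials is the transcendence degree, and by Nakayama's lemma it is at
most the dimension of the fibre at `x`.

*Lifted flows.* A flow `φ` on `X`, an action of the additive group given by its coaction
`ℝ[X] → ℝ[X][t]`, lifts to `Y` with any speed `w = v q(v)` (`Suspension.liftFlow`): it fixes `v`,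
moves `x` to `φ_{tw}(x)`, and the relation `uv = f` determines its effect on `u`. The level
`v = c ≠ 0` is a copy of `X`, and a polynomial `q` can be prescribed at finitely many points, so
`SAut(Y)` acts on finitely many levels independently, on each of them through all of `SAut(X)`
(`Suspension.exists_lift_SAut`). On `v = 0` the lifted flow translates `u` by a multiple of
the derivative of `f` along `φ`. Exchanging `u` and `v` gives flows that fix `u`.

*Transitivity* (`Suspension.exists_SAut_standard`). Given finitely many smooth points, the
translations move those with `u = v = 0` to points with `v ≠ 0`, since `X` is flexible and
`df ≠ 0` there. As `f` takes all real values on smooth points, a motion preserving `u` makes all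
`v` nonzero, a motion preserving `v` makes the values of `u` equal to `1, 2, …`, and a last
motion preserving `u` leads to prescribed points.

*Flexibility* (`Suspension.isFlexible`). By transitivity one flexible smooth point suffices. At a
point with `uv ≠ 0` and `df ≠ 0` the velocities of the flows fixing `v` span the tangent space of
the level of `v`, and a flow fixing `u` is transversal to it. Such a point exists because
otherwise `f` would be constant on the orbits of `SAut(X)`.
-/

/-! ### Points and tangent vectors -/

namespace RealPoints

variable {A B : Type u} [CommRing A] [Algebra ℝ A] [CommRing B] [Algebra ℝ B]

/-- Two points are equal as soon as every regular function takes the same value at both. -/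
lemma ext_ev {x y : RealPoints A} (h : ∀ a, x.ev a = y.ev a) : x = y :=
  AlgHom.ext h

lemma smul_ev (g : A ≃ₐ[ℝ] A) (x : RealPoints A) (a : A) : (g • x).ev a = x.ev (g⁻¹ a) := rfl

/-- The morphism of varieties `Y → X` induced by a homomorphism `ℝ[X] → ℝ[Y]`. -/
def comap (h : A →ₐ[ℝ] B) (y : RealPoints B) : RealPoints A := y.ev.comp h

lemma comap_ev (h : A →ₐ[ℝ] B) (y : RealPoints B) (a : A) : (y.comap h).ev a = y.ev (h a) := rfl

lemma comp_mem_tangentSpace_comap (h : A →ₐ[ℝ] B) {y : RealPoints B} {D : B →ₗ[ℝ] ℝ}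
    (hD : D ∈ y.tangentSpace) : D ∘ₗ h.toLinearMap ∈ (y.comap h).tangentSpace := by
  intro a b
  simpa [comap_ev] using hD (h a) (h b)

lemma tangent_one {x : RealPoints A} {D : A →ₗ[ℝ] ℝ} (hD : D ∈ x.tangentSpace) : D 1 = 0 := by
  have := hD 1 1
  simp only [mul_one, map_one, one_mul] at this
  linarith

lemma tangent_algebraMap {x : RealPoints A} {D : A →ₗ[ℝ] ℝ} (hD : D ∈ x.tangentSpace) (r : ℝ) :
    D (algebraMap ℝ A r) = 0 := by
  rw [Algebra.algebraMap_eq_smul_one, map_smul, tangent_one hD, smul_zero]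

/-- A tangent vector is the `ε`-part of a homomorphism to the dual numbers that lifts the point. -/
def tangentHom (x : RealPoints A) (D : A →ₗ[ℝ] ℝ) (hD : D ∈ x.tangentSpace) :
    A →ₐ[ℝ] DualNumber ℝ :=
  AlgHom.ofLinearMap
    ((TrivSqZeroExt.inlAlgHom ℝ ℝ ℝ).toLinearMap ∘ₗ x.ev.toLinearMap +
      TrivSqZeroExt.inrHom ℝ ℝ ∘ₗ D)
    (by ext <;> simp [tangent_one hD])
    (by
      intro a b
      ext
      · simp
      · simp only [LinearMap.add_apply, LinearMap.comp_apply, AlgHom.toLinearMap_apply, map_mul,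
          TrivSqZeroExt.inlAlgHom_apply, TrivSqZeroExt.inrHom_apply, TrivSqZeroExt.snd_add,
          TrivSqZeroExt.snd_mul, TrivSqZeroExt.snd_inl, TrivSqZeroExt.snd_inr,
          TrivSqZeroExt.fst_add, TrivSqZeroExt.fst_inl, TrivSqZeroExt.fst_inr, hD a b,
          smul_eq_mul, MulOpposite.smul_eq_mul_unop, MulOpposite.unop_op]
        ring)

@[simp]
lemma fst_tangentHom (x : RealPoints A) (D : A →ₗ[ℝ] ℝ) (hD : D ∈ x.tangentSpace) (a : A) :
    (x.tangentHom D hD a).fst = x.ev a := by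
  simp [tangentHom]

@[simp]
lemma snd_tangentHom (x : RealPoints A) (D : A →ₗ[ℝ] ℝ) (hD : D ∈ x.tangentSpace) (a : A) :
    (x.tangentHom D hD a).snd = D a := by
  simp [tangentHom]

/-- The tangent vector given by a homomorphism to the dual numbers that lifts the point `x`. -/
lemma snd_comp_mem_tangentSpace (x : RealPoints A) (h : A →ₐ[ℝ] DualNumber ℝ)
    (hx : ∀ a, (h a).fst = x.ev a) :
    TrivSqZeroExt.sndHom ℝ ℝ ∘ₗ h.toLinearMap ∈ x.tangentSpace := by
  intro a b
  simp [hx, TrivSqZeroExt.snd_mul, mul_comm]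

/-- An automorphism identifies the tangent spaces at a point and at its image. -/
def tangentSpaceSMul (g : A ≃ₐ[ℝ] A) (x : RealPoints A) :
    x.tangentSpace ≃ₗ[ℝ] (g • x).tangentSpace where
  toFun D := ⟨D.1 ∘ₗ (g⁻¹ : A ≃ₐ[ℝ] A).toLinearMap, fun a b => by
    simpa [smul_ev] using D.2 (g⁻¹ a) (g⁻¹ b)⟩
  invFun D := ⟨D.1 ∘ₗ g.toLinearMap, fun a b => by
    have h1 : ∀ c, (g⁻¹ : A ≃ₐ[ℝ] A) (g c) = c := fun c => g.symm_apply_apply c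
    simpa [smul_ev, h1] using D.2 (g a) (g b)⟩
  map_add' D E := by ext; simp
  map_smul' c D := by ext; simp
  left_inv D := by
    ext a
    exact congrArg D.1 (g.symm_apply_apply a)
  right_inv D := by
    ext a
    exact congrArg D.1 (g.apply_symm_apply a)

lemma smul_mem_regularLocus (g : A ≃ₐ[ℝ] A) {x : RealPoints A} (hx : x ∈ regularLocus A) :
    g • x ∈ regularLocus A := by
  change _ = _ at hx
  change _ = _
  rw [← hx, (tangentSpaceSMul g x).finrank_eq]

end RealPoints

/-! ### Algebraic flows -/

section Flows

variable {A : Type u} [CommRing A] [Algebra ℝ A]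

/-- Polynomials over an `ℝ`-algebra without zero divisors are determined by their values at
real numbers. -/
lemma Polynomial.eq_of_eval_real [IsDomain A] {p q : A[X]}
    (h : ∀ t : ℝ, p.eval (algebraMap ℝ A t) = q.eval (algebraMap ℝ A t)) : p = q := by
  refine eq_of_infinite_eval_eq p q (Set.Infinite.mono ?_
    (Set.infinite_range_of_injective (FaithfulSMul.algebraMap_injective ℝ A)))
  rintro _ ⟨t, rfl⟩
  exact h t

/-- An algebraic action of the additive group `(ℝ, +)`, not necessarily effective, together with
its coaction `ℝ[X] → ℝ[X][t]`. -/
structure AlgebraicFlow (A : Type u) [CommRing A] [Algebra ℝ A] where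
  /-- The action. -/
  toHom : Multiplicative ℝ →* (A ≃ₐ[ℝ] A)
  /-- The function `a` moved for the time `t`, as a polynomial in `t`. -/
  coaction : A →ₐ[ℝ] A[X]
  toHom_apply : ∀ (t : ℝ) (a : A),
    toHom (Multiplicative.ofAdd t) a = (coaction a).eval (algebraMap ℝ A t)

namespace GaAction

variable (φ : GaAction A)

/-- The polynomial in `t` describing `φ_t a`. -/
noncomputable def poly (a : A) : A[X] := (φ.algebraic a).choose

lemma eval_poly (a : A) (t : ℝ) :
    (φ.poly a).eval (algebraMap ℝ A t) = φ.toHom (Multiplicative.ofAdd t) a :=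
  ((φ.algebraic a).choose_spec t).symm

/-- An effective action on a variety is in particular an algebraic flow. -/
noncomputable def toFlow [IsDomain A] : AlgebraicFlow A where
  toHom := φ.toHom
  coaction :=
    { toFun := φ.poly
      map_one' := Polynomial.eq_of_eval_real fun t => by simp [eval_poly]
      map_mul' := fun a b => Polynomial.eq_of_eval_real fun t => by simp [eval_poly]
      map_zero' := Polynomial.eq_of_eval_real fun t => by simp [eval_poly]
      map_add' := fun a b => Polynomial.eq_of_eval_real fun t => by simp [eval_poly]
      commutes' := fun r => Polynomial.eq_of_eval_real fun t => by
        simp [eval_poly, Polynomial.algebraMap_apply] }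
  toHom_apply t a := (φ.eval_poly a t).symm

end GaAction

namespace AlgebraicFlow

variable (F : AlgebraicFlow A)

/-- The automorphism given by the flow at the time `t`. -/
def aut (t : ℝ) : A ≃ₐ[ℝ] A := F.toHom (Multiplicative.ofAdd t)

lemma aut_apply (t : ℝ) (a : A) : F.aut t a = (F.coaction a).eval (algebraMap ℝ A t) :=
  F.toHom_apply t a

lemma aut_zero : F.aut 0 = 1 := by simp [AlgebraicFlow.aut]

lemma aut_add (s t : ℝ) : F.aut (s + t) = F.aut s * F.aut t := by
  simp [AlgebraicFlow.aut, ofAdd_add]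

lemma aut_neg (t : ℝ) : F.aut (-t) = (F.aut t)⁻¹ := by simp [AlgebraicFlow.aut, ofAdd_neg]

/-- The vector field generating the flow, as a map on functions. -/
noncomputable def generator (a : A) : A := (F.coaction a).coeff 1

lemma coaction_coeff_zero (a : A) : (F.coaction a).coeff 0 = a := by
  have := F.aut_apply 0 a
  rw [aut_zero, map_zero, ← coeff_zero_eq_eval_zero] at this
  exact this.symm

/-- The value of the function `a` along the orbit of `x`, as a polynomial in the time. -/
lemma aut_smul_ev (t : ℝ) (x : RealPoints A) (a : A) :
    (F.aut t • x).ev a = ((F.coaction a).map x.ev.toRingHom).eval (-t) := by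
  have h : -t = x.ev.toRingHom (algebraMap ℝ A (-t)) := by simp
  rw [RealPoints.smul_ev, ← aut_neg, aut_apply]
  conv_rhs => rw [h, eval_map_apply]
  rfl

lemma hasDerivAt_aut_smul (s : ℝ) (x : RealPoints A) (a : A) :
    HasDerivAt (fun t : ℝ => (F.aut t • x).ev a)
      (-(derivative ((F.coaction a).map x.ev.toRingHom)).eval (-s)) s := by
  simp_rw [aut_smul_ev]
  have := (((F.coaction a).map x.ev.toRingHom).hasDerivAt (-s)).comp s (hasDerivAt_neg s)
  simpa [Function.comp_def] using this

/-- The velocity at `x` of the flow. The sign comes from the action on points, which evaluates a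
function at the image of a point through the inverse automorphism. -/
noncomputable def velocity (x : RealPoints A) : A →ₗ[ℝ] ℝ :=
  -(x.ev.toLinearMap ∘ₗ (Polynomial.lcoeff A 1).restrictScalars ℝ ∘ₗ F.coaction.toLinearMap)

lemma velocity_apply (x : RealPoints A) (a : A) : F.velocity x a = -x.ev (F.generator a) := rfl

lemma hasDerivAt_velocity (x : RealPoints A) (a : A) :
    HasDerivAt (fun t : ℝ => (F.aut t • x).ev a) (F.velocity x a) 0 := by
  convert F.hasDerivAt_aut_smul 0 x a using 1
  rw [velocity_apply, neg_zero, ← coeff_zero_eq_eval_zero, coeff_derivative, coeff_map]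
  simp [generator]

/-- The velocities of flows are tangent vectors. -/
lemma velocity_mem_tangentSpace (x : RealPoints A) : F.velocity x ∈ x.tangentSpace := by
  intro a b
  have h := (F.hasDerivAt_velocity x a).mul (F.hasDerivAt_velocity x b)
  have h0 : F.aut 0 • x = x := by rw [aut_zero, one_smul]
  have h' := h.congr_of_eventuallyEq (f₁ := fun t => (F.aut t • x).ev (a * b))
    (.of_forall fun t => map_mul (F.aut t • x).ev a b)
  rw [(F.hasDerivAt_velocity x (a * b)).unique h', h0]
  ring

variable [IsDomain A]

/-- The kernel of an algebraic flow is Zariski closed, hence `0` or `ℝ`. -/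
lemma eq_one_or_injective :
    (∀ t, F.toHom (Multiplicative.ofAdd t) = 1) ∨ Function.Injective F.toHom := by
  by_contra! H
  obtain ⟨⟨t, ht⟩, hinj⟩ := H
  rw [injective_iff_map_eq_one] at hinj
  push Not at hinj
  obtain ⟨s, hs, hs0⟩ := hinj
  obtain ⟨s, rfl⟩ := Multiplicative.ofAdd.surjective s
  have hs0 : s ≠ 0 := fun h => hs0 (by rw [h, ofAdd_zero])
  apply ht
  ext a
  -- the coaction of `a` takes the value `a` at all the multiples of the period `s`
  have key : F.coaction a = C a := by
    refine eq_of_infinite_eval_eq _ _ (Set.Infinite.mono ?_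
      (Set.infinite_range_of_injective (f := fun n : ℕ => algebraMap ℝ A (n * s))
        ((FaithfulSMul.algebraMap_injective ℝ A).comp fun m n h => by simpa [hs0] using h)))
    rintro _ ⟨n, rfl⟩
    have : F.toHom (Multiplicative.ofAdd ((n : ℝ) * s)) = 1 := by
      rw [← nsmul_eq_mul, ofAdd_nsmul, map_pow, hs, one_pow]
    have h2 := F.toHom_apply (n * s) a
    rw [this] at h2
    simpa using h2.symm
  rw [F.toHom_apply, key]
  simp

lemma aut_mem_SAut (t : ℝ) : F.aut t ∈ SAut A := by
  rcases F.eq_one_or_injective with h | h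
  · rw [AlgebraicFlow.aut, h]; exact one_mem _
  · exact Subgroup.mem_iSup_of_mem (S := GaAction.subgroup)
      (i := ⟨F.toHom, h, fun a => ⟨_, fun t => F.toHom_apply t a⟩⟩) ⟨_, rfl⟩

lemma velocity_mem_span (x : RealPoints A) :
    F.velocity x ∈ Submodule.span ℝ (orbitVelocities x) := by
  rcases F.eq_one_or_injective with h | h
  · convert Submodule.zero_mem _
    ext a
    refine (F.hasDerivAt_velocity x a).unique ?_
    simp only [AlgebraicFlow.aut, h, one_smul]
    exact hasDerivAt_const _ _
  · exact Submodule.subset_span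
      ⟨⟨F.toHom, h, fun a => ⟨_, fun t => F.toHom_apply t a⟩⟩, F.hasDerivAt_velocity x⟩

lemma exists_velocity_eq {x : RealPoints A} {D : A →ₗ[ℝ] ℝ} (hD : D ∈ orbitVelocities x) :
    ∃ F : AlgebraicFlow A, F.velocity x = D := by
  obtain ⟨φ, hφ⟩ := hD
  exact ⟨φ.toFlow, LinearMap.ext fun a => (φ.toFlow.hasDerivAt_velocity x a).unique (hφ a)⟩

/-- Induction on the elements of the special automorphism group. -/
@[elab_as_elim]
lemma SAut_induction {p : (A ≃ₐ[ℝ] A) → Prop} {g : A ≃ₐ[ℝ] A} (hg : g ∈ SAut A)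
    (flow : ∀ (F : AlgebraicFlow A) (t : ℝ), p (F.aut t)) (one : p 1)
    (mul : ∀ g h, p g → p h → p (g * h)) : p g := by
  refine Subgroup.iSup_induction _ (C := p) hg ?_ one mul
  rintro φ _ ⟨t, rfl⟩
  exact flow φ.toFlow (Multiplicative.toAdd t)

/-- The coaction is coassociative: flowing for the time `d` and then for the time `c` is the same
as flowing for the time `c + d`, for times that are elements of any algebra over `A`. -/
lemma eval₂_eval₂_coaction {B : Type*} [CommRing B] (i : A →+* B) (c d : B) (a : A) :
    (F.coaction a).eval₂ ((eval₂RingHom i c).comp F.coaction.toRingHom) d =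
      (F.coaction a).eval₂ i (c + d) := by
  have key : (F.coaction a).map F.coaction.toRingHom =
      (F.coaction a).eval₂ (C.comp C) (C X + X) := by
    refine eq_of_infinite_eval_eq _ _ (Set.Infinite.mono ?_
      (Set.infinite_range_of_injective (f := fun t : ℝ => (C (algebraMap ℝ A t) : A[X]))
        (C_injective.comp (FaithfulSMul.algebraMap_injective ℝ A))))
    rintro _ ⟨t, rfl⟩
    refine eq_of_eval_real fun s => ?_
    -- both sides are the function `a`, moved first for the time `t` and then for the time `s`
    have h := congrArg (fun g => g a) (F.aut_add s t)
    simp only [AlgEquiv.mul_apply, aut_apply] at h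
    have hs : (F.coaction ((F.coaction a).eval (algebraMap ℝ A t))).eval (algebraMap ℝ A s) =
        (F.coaction a).eval₂ ((evalRingHom (algebraMap ℝ A s)).comp F.coaction.toRingHom)
          (algebraMap ℝ A t) := by
      have := hom_eval₂ (F.coaction a) (RingHom.id A)
        ((evalRingHom (algebraMap ℝ A s)).comp F.coaction.toRingHom) (algebraMap ℝ A t)
      simpa [Polynomial.algebraMap_apply] using this
    rw [hs] at h
    rw [eval_map, ← coe_evalRingHom, ← coe_evalRingHom (C _), hom_eval₂, hom_eval₂, hom_eval₂]
    simp only [coe_evalRingHom, eval_C, eval_add, eval_X]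
    rw [← h, eval, map_add]
    congr 1
    ext; simp
  have := congrArg (eval₂RingHom (eval₂RingHom i c) d) key
  simp only [coe_eval₂RingHom, eval₂_map, hom_eval₂] at this
  rw [this]
  congr 1
  · ext; simp
  · simp

end AlgebraicFlow

end Flows

/-! ### The coordinate ring of a suspension -/

namespace Suspension

section Coordinates

variable {A B : Type u} [CommRing A] [Algebra ℝ A] [CommRing B] [Algebra ℝ B] {f : A}
  (e : B ≃ₐ[ℝ] Suspension A f)

/-- The inclusion `ℝ[X] → ℝ[Susp(X, f)]` of the functions on the base. -/
noncomputable def base : A →ₐ[ℝ] B :=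
  e.symm.toAlgHom.comp ((Ideal.Quotient.mkₐ ℝ _).comp (IsScalarTower.toAlgHom ℝ A _))

/-- The coordinate `u` of a suspension. -/
noncomputable def u : B := e.symm (Ideal.Quotient.mk _ (MvPolynomial.X 0))

/-- The coordinate `v` of a suspension. -/
noncomputable def v : B := e.symm (Ideal.Quotient.mk _ (MvPolynomial.X 1))

lemma base_apply (a : A) : base e a = e.symm (Ideal.Quotient.mk _ (MvPolynomial.C a)) := rfl

lemma u_mul_v : u e * v e = base e f := by
  rw [u, v, base_apply, ← map_mul, ← map_mul]
  congr 1
  exact Ideal.Quotient.eq.mpr (Ideal.subset_span rfl)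

/-- The functions on the base together with `u` and `v` generate the coordinate ring. -/
lemma induction {p : B → Prop} (hbase : ∀ a, p (base e a)) (hadd : ∀ b c, p b → p c → p (b + c))
    (hu : ∀ b, p b → p (b * u e)) (hv : ∀ b, p b → p (b * v e)) (b : B) : p b := by
  obtain ⟨c, rfl⟩ := e.symm.surjective b
  obtain ⟨c, rfl⟩ := Ideal.Quotient.mk_surjective c
  induction c using MvPolynomial.induction_on with
  | C a => exact hbase a
  | add b c hb hc => rw [map_add, map_add]; exact hadd _ _ hb hc
  | mul_X b i hb =>
    rw [map_mul, map_mul]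
    fin_cases i
    · exact hu _ hb
    · exact hv _ hb

lemma hom_ext {C : Type*} [Semiring C] [Algebra ℝ C] {g h : B →ₐ[ℝ] C}
    (hbase : ∀ a, g (base e a) = h (base e a)) (hu : g (u e) = h (u e)) (hv : g (v e) = h (v e)) :
    g = h :=
  AlgHom.ext <| induction e hbase (fun b c hb hc => by rw [map_add, map_add, hb, hc])
    (fun b hb => by rw [map_mul, map_mul, hb, hu]) (fun b hb => by rw [map_mul, map_mul, hb, hv])

/-- The universal property of the coordinate ring of a suspension. -/
lemma exists_lift {C : Type*} [CommRing C] [Algebra ℝ C] (j : A →ₐ[ℝ] C) (a b : C)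
    (h : a * b = j f) :
    ∃ g : B →ₐ[ℝ] C, (∀ x, g (base e x) = j x) ∧ g (u e) = a ∧ g (v e) = b := by
  let g₀ : Suspension A f →+* C := Ideal.Quotient.lift _
    (MvPolynomial.eval₂Hom j.toRingHom ![a, b]) fun x hx => by
      obtain ⟨y, rfl⟩ := Ideal.mem_span_singleton'.mp hx
      simp [h]
  have hC : ∀ x : A, g₀ (Ideal.Quotient.mk _ (MvPolynomial.C x)) = j x := fun x => by simp [g₀]
  let g₁ : Suspension A f →ₐ[ℝ] C :=
    { g₀ with
      commutes' := fun r => by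
        have := hC (algebraMap ℝ A r)
        rw [AlgHom.commutes] at this
        exact this }
  refine ⟨g₁.comp e.toAlgHom, fun x => ?_, ?_, ?_⟩
  · change g₀ (e (e.symm _)) = _
    rw [e.apply_symm_apply]
    exact hC x
  · simp [u, g₁, g₀]
  · simp [v, g₁, g₀]

/-- The universal homomorphism out of the coordinate ring of a suspension. -/
noncomputable def lift {C : Type*} [CommRing C] [Algebra ℝ C] (j : A →ₐ[ℝ] C) (a b : C)
    (h : a * b = j f) : B →ₐ[ℝ] C := (exists_lift e j a b h).choose

section Lift

variable {C : Type*} [CommRing C] [Algebra ℝ C] (j : A →ₐ[ℝ] C) (a b : C) (h : a * b = j f)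

lemma lift_base (x : A) : lift e j a b h (base e x) = j x :=
  (exists_lift e j a b h).choose_spec.1 x

lemma lift_u : lift e j a b h (u e) = a := (exists_lift e j a b h).choose_spec.2.1

lemma lift_v : lift e j a b h (v e) = b := (exists_lift e j a b h).choose_spec.2.2

end Lift

/-- The involution of a suspension that exchanges `u` and `v`. -/
noncomputable def swapHom : B →ₐ[ℝ] B :=
  lift e (base e) (v e) (u e) (by rw [mul_comm, u_mul_v])

lemma swapHom_comp_swapHom : (swapHom e).comp (swapHom e) = AlgHom.id ℝ B :=
  hom_ext e (by simp [swapHom, lift_base]) (by simp [swapHom, lift_u, lift_v])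
    (by simp [swapHom, lift_u, lift_v])

/-- The presentation of a suspension with the roles of `u` and `v` exchanged. -/
noncomputable def swap : B ≃ₐ[ℝ] Suspension A f :=
  (AlgEquiv.ofAlgHom _ _ (swapHom_comp_swapHom e) (swapHom_comp_swapHom e)).trans e

lemma swap_symm_apply (x : Suspension A f) : (swap e).symm x = swapHom e (e.symm x) := rfl

@[simp]
lemma base_swap : base (swap e) = base e :=
  AlgHom.ext fun a => by
    rw [base_apply, swap_symm_apply, ← base_apply, swapHom, lift_base]

@[simp]
lemma u_swap : u (swap e) = v e := by
  rw [u, swap_symm_apply, ← u, swapHom, lift_u]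

@[simp]
lemma v_swap : v (swap e) = u e := by
  rw [v, swap_symm_apply, ← v, swapHom, lift_v]

/-- Every function on a suspension can be written as `p(u) + v q(v)`, since `uv` is a function on
the base. -/
lemma exists_normal_form (b : B) :
    ∃ p q : A[X], b = p.eval₂ (base e).toRingHom (u e) +
      v e * q.eval₂ (base e).toRingHom (v e) := by
  induction b using induction e with
  | hbase a => exact ⟨C a, 0, by simp⟩
  | hadd b c hb hc =>
    obtain ⟨p, q, rfl⟩ := hb
    obtain ⟨p', q', rfl⟩ := hc
    exact ⟨p + p', q + q', by simp only [eval₂_add]; ring⟩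
  | hu b hb =>
    obtain ⟨p, q, rfl⟩ := hb
    refine ⟨p * X + C (f * q.coeff 0), C f * q.divX, ?_⟩
    conv_lhs => rw [← divX_mul_X_add q]
    have := u_mul_v e
    simp only [eval₂_add, eval₂_mul, eval₂_X, eval₂_C, map_mul, AlgHom.toRingHom_eq_coe,
      RingHom.coe_coe, ← this]
    ring
  | hv b hb =>
    obtain ⟨p, q, rfl⟩ := hb
    refine ⟨C f * p.divX, C (p.coeff 0) + q * X, ?_⟩
    conv_lhs => rw [← divX_mul_X_add p]
    have := u_mul_v e
    simp only [eval₂_add, eval₂_mul, eval₂_X, eval₂_C, AlgHom.toRingHom_eq_coe,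
      RingHom.coe_coe, ← this]
    ring

end Coordinates

section Laurent

variable {A B : Type u} [CommRing A] [Algebra ℝ A] [CommRing B] [Algebra ℝ B] {f : A}
  (e : B ≃ₐ[ℝ] Suspension A f)

open LaurentPolynomial in
/-- The restriction of functions to the open subset `v ≠ 0`, which is `X × (𝔸¹ ∖ 0)`. -/
noncomputable def toLaurent : B →ₐ[ℝ] LaurentPolynomial A :=
  lift e (IsScalarTower.toAlgHom ℝ A (LaurentPolynomial A)) (LaurentPolynomial.C f * T (-1)) (T 1)
    (by rw [mul_assoc, ← T_add]; simp [LaurentPolynomial.algebraMap_apply])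

open LaurentPolynomial in
omit [Algebra ℝ A] in
lemma coeff_C_mul_T (a : A) (m n : ℤ) :
    (LaurentPolynomial.C a * T m).coeff n = if m = n then a else 0 := by
  rw [← single_eq_C_mul_T]
  exact Finsupp.single_apply

open LaurentPolynomial in
omit [Algebra ℝ A] in
lemma coeff_eval₂_C_mul_T_neg_one (f : A) (p : A[X]) (n : ℕ) :
    (p.eval₂ LaurentPolynomial.C (LaurentPolynomial.C f * T (-1))).coeff (-n) =
      p.coeff n * f ^ n := by
  induction p using Polynomial.induction_on' with
  | add p q hp hq => simp [eval₂_add, hp, hq, add_mul]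
  | monomial k a =>
    have : LaurentPolynomial.C a * (LaurentPolynomial.C f * T (-1)) ^ k =
        LaurentPolynomial.C (a * f ^ k) * T (-k) := by
      rw [mul_pow, T_pow, ← map_pow, ← mul_assoc, ← map_mul]
      simp
    rw [eval₂_monomial, this, coeff_C_mul_T, coeff_monomial]
    simp only [neg_inj, Nat.cast_inj]
    split_ifs with h
    · rw [h]
    · rw [zero_mul]

open LaurentPolynomial in
omit [Algebra ℝ A] in
lemma coeff_T_mul_eval₂_T_one (q : A[X]) (n : ℤ) :
    (T 1 * q.eval₂ LaurentPolynomial.C (T 1)).coeff n =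
      if 0 < n then q.coeff (n - 1).toNat else 0 := by
  induction q using Polynomial.induction_on' with
  | add p q hp hq =>
    rw [eval₂_add, mul_add, AddMonoidAlgebra.coeff_add, Finsupp.add_apply, hp, hq]
    split_ifs <;> simp
  | monomial k a =>
    have : T 1 * (LaurentPolynomial.C a * T 1 ^ k) = LaurentPolynomial.C a * T (k + 1) := by
      rw [T_pow, mul_left_comm, ← T_add]
      congr 2
      ring
    rw [eval₂_monomial, this, coeff_C_mul_T, coeff_monomial]
    split_ifs <;> first | rfl | omega

/-- In the image of `p(u) + v q(v)` the polynomial `q` contributes the positive powers of `T`, and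
`p` the others, with coefficients multiplied by powers of `f`. -/
lemma toLaurent_injective [IsDomain A] (hf : f ≠ 0) : Function.Injective (toLaurent e) := by
  rw [injective_iff_map_eq_zero]
  intro b hb
  obtain ⟨p, q, rfl⟩ := exists_normal_form e b
  have hj : ((toLaurent e).toRingHom.comp (base e).toRingHom) = LaurentPolynomial.C :=
    RingHom.ext fun a => lift_base ..
  have hb' : p.eval₂ LaurentPolynomial.C (LaurentPolynomial.C f * LaurentPolynomial.T (-1)) +
      LaurentPolynomial.T 1 * q.eval₂ LaurentPolynomial.C (LaurentPolynomial.T 1) = 0 := by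
    have h := hom_eval₂ p (base e).toRingHom (toLaurent e).toRingHom (u e)
    have h' := hom_eval₂ q (base e).toRingHom (toLaurent e).toRingHom (v e)
    have hu : (toLaurent e).toRingHom (u e) = _ := lift_u ..
    have hv : (toLaurent e).toRingHom (v e) = _ := lift_v ..
    rw [hj, hu] at h
    rw [hj, hv] at h'
    rw [← h, ← h', ← hv, ← map_mul, ← map_add]
    exact hb
  have hp : p = 0 := by
    ext n
    have := congrArg (fun x => x.coeff (-n)) hb'
    simp only [AddMonoidAlgebra.coeff_add, Finsupp.add_apply, coeff_eval₂_C_mul_T_neg_one,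
      coeff_T_mul_eval₂_T_one] at this
    rw [if_neg (by omega)] at this
    simpa [hf] using this
  have hq : q = 0 := by
    ext n
    have := congrArg (fun x => x.coeff (n + 1)) hb'
    simp only [hp, eval₂_zero, zero_add, coeff_T_mul_eval₂_T_one] at this
    rw [if_pos (by omega)] at this
    simpa using this
  simp [hp, hq]

include e in
lemma isDomain [IsDomain A] (hf : f ≠ 0) : IsDomain B :=
  (toLaurent_injective e hf).isDomain (toLaurent e).toRingHom

lemma v_ne_zero [IsDomain A] : v e ≠ 0 := fun h => by
  have h2 : toLaurent e (v e) = LaurentPolynomial.T 1 := lift_v ..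
  rw [h, map_zero] at h2
  simpa using congrArg (fun x => x.coeff 1) h2

lemma v_ne_one [IsDomain A] : v e ≠ 1 := fun h => by
  have h2 : toLaurent e (v e) = LaurentPolynomial.T 1 := lift_v ..
  rw [h, map_one, ← LaurentPolynomial.T_zero] at h2
  have := congrArg (fun x => x.coeff 1) h2
  simp only [LaurentPolynomial.T_apply] at this
  simp at this

include e in
lemma finiteType [Algebra.FiniteType ℝ A] : Algebra.FiniteType ℝ B :=
  have : Algebra.FiniteType ℝ (MvPolynomial (Fin 2) A) :=
    Algebra.FiniteType.trans (S := A) ‹_› inferInstance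
  have : Algebra.FiniteType ℝ (Suspension A f) := inferInstance
  this.equiv e.symm

include e in
/-- A suspension has one dimension more than its base. -/
lemma ringKrullDim_eq [IsDomain A] [Algebra.FiniteType ℝ A] (hf : f ≠ 0) :
    ringKrullDim B = ringKrullDim A + 1 := by
  have := isDomain e hf
  have : IsNoetherianRing A := Algebra.FiniteType.isNoetherianRing ℝ A
  apply le_antisymm
  · have h1 : (MvPolynomial.X 0 * MvPolynomial.X 1 - MvPolynomial.C f :
        MvPolynomial (Fin 2) A) ≠ 0 := fun h => by
      simpa [hf] using congrArg (MvPolynomial.aeval (0 : Fin 2 → A)) h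
    have h2 := ringKrullDim_quotient_succ_le_of_nonZeroDivisor (mem_nonZeroDivisors_of_ne_zero h1)
    rw [MvPolynomial.ringKrullDim_of_isNoetherianRing] at h2
    have h3 : ringKrullDim B = ringKrullDim (Suspension A f) :=
      ringKrullDim_eq_of_ringEquiv e.toRingEquiv
    rw [h3]
    generalize ringKrullDim (Suspension A f) = x at *
    generalize ringKrullDim A = y at *
    rw [Nat.card_fin, Nat.cast_two, ← one_add_one_eq_two, ← add_assoc] at h2
    exact (ENat.WithBot.add_le_add_one_right_iff).mp h2
  · -- the hyperplane section `v = 1` is isomorphic to the base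
    let g : B →ₐ[ℝ] A := lift e (AlgHom.id ℝ A) f 1 (mul_one f)
    refine ringKrullDim_succ_le_of_surjective g.toRingHom (fun a => ⟨base e a, lift_base ..⟩)
      (mem_nonZeroDivisors_of_ne_zero (sub_ne_zero.mpr (v_ne_one e))) ?_
    change g (v e - 1) = 0
    rw [map_sub, map_one, sub_eq_zero]
    exact lift_v ..

end Laurent

end Suspension

/-! ### The tangent dimension is at least the dimension -/

section TangentDimension

open TensorProduct

variable {A : Type u} [CommRing A] [Algebra ℝ A]

/-- The tangent spaces of an affine variety are finite-dimensional. -/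
instance RealPoints.finite_tangentSpace [Algebra.FiniteType ℝ A] (x : RealPoints A) :
    Module.Finite ℝ x.tangentSpace := by
  obtain ⟨s, hs⟩ := (inferInstance : Algebra.FiniteType ℝ A)
  let r : x.tangentSpace →ₗ[ℝ] (s → ℝ) := LinearMap.pi fun a => LinearMap.applyₗ a.1 ∘ₗ
    x.tangentSpace.subtype
  -- a tangent vector is determined by its values on generators
  refine Module.Finite.of_injective r ?_
  rw [injective_iff_map_eq_zero]
  rintro ⟨D, hD⟩ h
  refine Subtype.ext (LinearMap.ext fun a => ?_)
  change D a = 0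
  have ha : a ∈ Algebra.adjoin ℝ (s : Set A) := hs ▸ Algebra.mem_top
  induction ha using Algebra.adjoin_induction with
  | mem a ha => exact congrFun h ⟨a, ha⟩
  | algebraMap c => exact tangent_algebraMap hD c
  | add a b _ _ ha hb => rw [map_add, ha, hb, add_zero]
  | mul a b _ _ ha hb =>
    rw [hD a b, ha, hb, mul_zero, mul_zero, add_zero]

instance RealPoints.free_tangentSpace (x : RealPoints A) : Module.Free ℝ x.tangentSpace :=
  Module.Free.of_divisionRing ℝ x.tangentSpace

section Fibre

variable {M : Type*} [AddCommGroup M] [Module A M] [Module ℝ M] [IsScalarTower ℝ A M]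

/-- The functions vanishing at the point `x`. -/
def RealPoints.ideal (x : RealPoints A) : Ideal A := RingHom.ker x.ev

lemma RealPoints.mk_smul (x : RealPoints A) (a : A) (m : M) :
    (x.ideal • ⊤ : Submodule A M).mkQ (a • m) = x.ev a • (x.ideal • ⊤ : Submodule A M).mkQ m := by
  change _ = (x.ideal • ⊤ : Submodule A M).mkQ (x.ev a • m)
  rw [← sub_eq_zero, ← map_sub, ← algebraMap_smul A (x.ev a) m, ← sub_smul, Submodule.mkQ_apply,
    Submodule.Quotient.mk_eq_zero]
  exact Submodule.smul_mem_smul (by simp [RealPoints.ideal, RingHom.mem_ker]) trivial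

lemma RealPoints.span_image_mk (x : RealPoints A) {S : Set M} (hS : Submodule.span A S = ⊤) :
    Submodule.span ℝ ((x.ideal • ⊤ : Submodule A M).mkQ '' S) = ⊤ := by
  rw [eq_top_iff]
  rintro y -
  obtain ⟨m, rfl⟩ := Submodule.mkQ_surjective _ y
  have hm : m ∈ Submodule.span A S := hS ▸ trivial
  induction hm using Submodule.span_induction with
  | mem m hm => exact Submodule.subset_span ⟨m, hm, rfl⟩
  | zero => rw [map_zero]; exact zero_mem _
  | add m n _ _ hm hn => rw [map_add]; exact add_mem hm hn
  | smul a m _ hm => rw [mk_smul]; exact Submodule.smul_mem _ _ hm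

instance RealPoints.finite_fibre [Module.Finite A M] (x : RealPoints A) :
    Module.Finite ℝ (M ⧸ (x.ideal • ⊤ : Submodule A M)) := by
  classical
  obtain ⟨S, hS⟩ := Module.Finite.fg_top (R := A) (M := M)
  refine ⟨⟨S.image (x.ideal • ⊤ : Submodule A M).mkQ, ?_⟩⟩
  rw [Finset.coe_image, x.span_image_mk hS]

/-- The dimension of the fibre of a finitely generated module at a point is at least its
generic rank, by Nakayama's lemma. -/
lemma RealPoints.finrank_tensor_le (K : Type*) [Field K] [Algebra A K] [FaithfulSMul A K]
    [Module.Finite A M] (x : RealPoints A) :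
    Module.finrank K (K ⊗[A] M) ≤ Module.finrank ℝ (M ⧸ (x.ideal • ⊤ : Submodule A M)) := by
  let b := Module.finBasis ℝ (M ⧸ (x.ideal • ⊤ : Submodule A M))
  choose w hw using fun i => Submodule.mkQ_surjective _ (b i)
  have hsup : (⊤ : Submodule A M) ≤ Submodule.span A (Set.range w) ⊔ x.ideal • ⊤ := by
    rintro m -
    have h : m - ∑ i, b.repr ((x.ideal • ⊤ : Submodule A M).mkQ m) i • w i ∈
        (x.ideal • ⊤ : Submodule A M) := by
      rw [← Submodule.Quotient.mk_eq_zero, ← Submodule.mkQ_apply, map_sub, sub_eq_zero, map_sum]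
      conv_lhs => rw [← b.sum_repr ((x.ideal • ⊤ : Submodule A M).mkQ m)]
      refine Finset.sum_congr rfl fun i _ => ?_
      rw [← hw i]
      rfl
    rw [← sub_add_cancel m (∑ i, b.repr ((x.ideal • ⊤ : Submodule A M).mkQ m) i • w i), add_comm]
    refine Submodule.add_mem_sup (Submodule.sum_mem _ fun i _ => ?_) h
    rw [← algebraMap_smul A (b.repr _ i) (w i)]
    exact Submodule.smul_mem _ _ (Submodule.subset_span ⟨i, rfl⟩)
  obtain ⟨r, hr, hr'⟩ := Submodule.exists_sub_one_mem_and_smul_le_of_fg_of_le_sup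
    (Module.Finite.fg_top (R := A) (M := M)) le_top hsup
  have hr0 : algebraMap A K r ≠ 0 := fun h => by
    rw [FaithfulSMul.algebraMap_eq_zero_iff] at h
    have : x.ev (r - 1) = 0 := hr
    simp [h] at this
  have hspan : Submodule.span K (Set.range fun i => (1 : K) ⊗ₜ[A] w i) = ⊤ := by
    have h1 : ∀ m ∈ Submodule.span A (Set.range w), (1 : K) ⊗ₜ[A] m ∈
        Submodule.span K (Set.range fun i => (1 : K) ⊗ₜ[A] w i) := by
      intro m hm
      induction hm using Submodule.span_induction with
      | mem m hm =>
        obtain ⟨i, rfl⟩ := hm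
        exact Submodule.subset_span ⟨i, rfl⟩
      | zero => rw [tmul_zero]; exact zero_mem _
      | add m n _ _ hm hn => rw [tmul_add]; exact add_mem hm hn
      | smul a m _ hm =>
        rw [tmul_smul, ← algebraMap_smul K a ((1 : K) ⊗ₜ[A] m)]
        exact Submodule.smul_mem _ _ hm
    rw [eq_top_iff]
    rintro z -
    induction z with
    | zero => exact zero_mem _
    | add y z hy hz => exact add_mem hy hz
    | tmul k m =>
      -- `r` maps `M` into the span of the `w i` and is invertible in `K`
      have h2 := Submodule.smul_mem _ (k * (algebraMap A K r)⁻¹)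
        (h1 (r • m) (hr' (Submodule.smul_mem_pointwise_smul m r ⊤ trivial)))
      rwa [tmul_smul, ← algebraMap_smul K r, smul_smul, mul_assoc, inv_mul_cancel₀ hr0, mul_one,
        smul_tmul', smul_eq_mul, mul_one] at h2
  rw [← finrank_top, ← hspan]
  exact (finrank_range_le_card _).trans (by simp)

end Fibre

/-- The linear forms on the fibre of `Ω` at `x` are tangent vectors at `x`. -/
lemma RealPoints.finrank_fibre_kaehler_le [Algebra.FiniteType ℝ A] (x : RealPoints A) :
    Module.finrank ℝ (Ω[A⁄ℝ] ⧸ (x.ideal • ⊤ : Submodule A Ω[A⁄ℝ])) ≤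
      Module.finrank ℝ x.tangentSpace := by
  let q := (x.ideal • ⊤ : Submodule A Ω[A⁄ℝ]).mkQ
  let r : Module.Dual ℝ (Ω[A⁄ℝ] ⧸ (x.ideal • ⊤ : Submodule A Ω[A⁄ℝ])) →ₗ[ℝ] x.tangentSpace :=
    { toFun := fun l => ⟨l ∘ₗ q.restrictScalars ℝ ∘ₗ (KaehlerDifferential.D ℝ A).toLinearMap, by
        intro a b
        simp [q, x.mk_smul, -Submodule.mkQ_apply]⟩
      map_add' := fun _ _ => rfl
      map_smul' := fun _ _ => rfl }
  rw [← Subspace.dual_finrank_eq]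
  refine LinearMap.finrank_le_finrank_of_injective (f := r) ?_
  rw [injective_iff_map_eq_zero]
  intro l hl
  have h : Submodule.span ℝ (q '' Set.range (KaehlerDifferential.D ℝ A)) = ⊤ :=
    x.span_image_mk (KaehlerDifferential.span_range_derivation ℝ A)
  refine LinearMap.ext_on_range (v := fun a => q (KaehlerDifferential.D ℝ A a)) ?_ fun a => ?_
  · rw [← h, ← Set.range_comp]
    rfl
  · exact congrArg (fun D : x.tangentSpace => D.1 a) hl

/-- Integral extensions do not raise the dimension, because their primes are incomparable in the
fibres. -/
lemma ringKrullDim_le_of_isIntegral {R S : Type*} [CommRing R] [CommRing S] [Algebra R S]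
    [Algebra.IsIntegral R S] : ringKrullDim S ≤ ringKrullDim R :=
  Order.krullDim_le_of_strictMono (PrimeSpectrum.comap (algebraMap R S)) fun _ _ h =>
    Ideal.IsIntegral.comap_lt_comap h

/-- A field that is algebraic over `ℝ[y₁, …, yₛ]` is formally étale over it, the
characteristic being zero, so that `dy₁, …, dyₛ` are a basis of its differentials. -/
lemma finrank_kaehler_eq (s : ℕ) (K : Type*) [Field K] [Algebra ℝ K]
    [Algebra (MvPolynomial (Fin s) ℝ) K] [IsScalarTower ℝ (MvPolynomial (Fin s) ℝ) K]
    [FaithfulSMul (MvPolynomial (Fin s) ℝ) K]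
    [Algebra.IsAlgebraic (MvPolynomial (Fin s) ℝ) K] :
    Module.finrank K Ω[K⁄ℝ] = s := by
  let R := MvPolynomial (Fin s) ℝ
  let _ : Algebra (FractionRing R) K := FractionRing.liftAlgebra R K
  have : IsScalarTower R (FractionRing R) K := FractionRing.isScalarTower_liftAlgebra R K
  have : CharZero (FractionRing R) := charZero_of_injective_algebraMap
    (algebraMap ℝ (FractionRing R)).injective
  have : Algebra.IsAlgebraic (FractionRing R) K := Algebra.IsAlgebraic.extendScalars (R := R)
    (FaithfulSMul.algebraMap_injective R (FractionRing R))
  have : Algebra.FormallyEtale (FractionRing R) K := Algebra.FormallyEtale.of_isSeparable _ _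
  have : Algebra.FormallyEtale R (FractionRing R) :=
    Algebra.FormallyEtale.of_isLocalization (nonZeroDivisors R)
  have : Algebra.FormallyEtale R K := Algebra.FormallyEtale.comp R (FractionRing R) K
  rw [← (KaehlerDifferential.tensorKaehlerEquivOfFormallyEtale ℝ R K).finrank_eq,
    Module.finrank_eq_card_basis ((KaehlerDifferential.mvPolynomialBasis ℝ (Fin s)).baseChange K)]
  simp

/-- The dimension of the Zariski tangent space at any point of an affine variety is at least the
dimension of the variety. -/
theorem RealPoints.ringKrullDim_le_finrank_tangentSpace [IsDomain A] [Algebra.FiniteType ℝ A]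
    (x : RealPoints A) : ringKrullDim A ≤ Module.finrank ℝ x.tangentSpace := by
  obtain ⟨s, g, hg, hint⟩ := exists_integral_inj_algHom_of_fg ℝ A
  let R := MvPolynomial (Fin s) ℝ
  let K := FractionRing A
  algebraize [g.toRingHom]
  have : IsScalarTower ℝ R A := IsScalarTower.of_algHom g
  have : Algebra.IsIntegral R A := ⟨hint⟩
  have hdim : ringKrullDim A ≤ s := by
    refine (ringKrullDim_le_of_isIntegral (R := R)).trans ?_
    rw [MvPolynomial.ringKrullDim_of_isNoetherianRing]
    simp
  have : FaithfulSMul R A := (faithfulSMul_iff_algebraMap_injective R A).mpr hg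
  have : FaithfulSMul R K := FaithfulSMul.trans R A K
  have : Algebra.IsAlgebraic A K :=
    (IsFractionRing.comap_isAlgebraic_iff (A := A) (K := K) (C := K)).mpr inferInstance
  have : Algebra.IsAlgebraic R K := Algebra.IsAlgebraic.trans R A K
  have : Algebra.FormallyEtale A K := Algebra.FormallyEtale.of_isLocalization (nonZeroDivisors A)
  have h1 := finrank_kaehler_eq s K
  rw [← (KaehlerDifferential.tensorKaehlerEquivOfFormallyEtale ℝ A K).finrank_eq] at h1
  have h2 := (x.finrank_tensor_le (M := Ω[A⁄ℝ]) K).trans x.finrank_fibre_kaehler_le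
  rw [h1] at h2
  exact hdim.trans (by exact_mod_cast h2)

end TangentDimension

/-! ### Smooth points of a suspension -/

namespace Suspension

variable {A B : Type u} [CommRing A] [Algebra ℝ A] [CommRing B] [Algebra ℝ B] {f : A}
  (e : B ≃ₐ[ℝ] Suspension A f)

lemma point_ext {P Q : RealPoints B} (hbase : P.comap (base e) = Q.comap (base e))
    (hu : P.ev (u e) = Q.ev (u e)) (hv : P.ev (v e) = Q.ev (v e)) : P = Q :=
  hom_ext e (fun a => congrArg (fun x : RealPoints A => x.ev a) hbase) hu hv

lemma ev_u_mul_ev_v (P : RealPoints B) :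
    P.ev (u e) * P.ev (v e) = (P.comap (base e)).ev f := by
  rw [← map_mul, u_mul_v]
  rfl

/-- Every solution of `uv = f(x)` is a point of the suspension. -/
lemma exists_point (x : RealPoints A) (a b : ℝ) (h : a * b = x.ev f) :
    ∃ P : RealPoints B, P.comap (base e) = x ∧ P.ev (u e) = a ∧ P.ev (v e) = b :=
  ⟨lift e x.ev a b h, RealPoints.ext_ev fun y => lift_base e x.ev a b h y, lift_u e x.ev a b h,
    lift_v e x.ev a b h⟩

lemma tangent_ext {P : RealPoints B} {D E : B →ₗ[ℝ] ℝ} (hD : D ∈ P.tangentSpace)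
    (hE : E ∈ P.tangentSpace) (hbase : ∀ a, D (base e a) = E (base e a))
    (hu : D (u e) = E (u e)) (hv : D (v e) = E (v e)) : D = E :=
  LinearMap.ext <| induction e hbase (fun b c hb hc => by rw [map_add, map_add, hb, hc])
    (fun b hb => by rw [hD, hE, hb, hu]) (fun b hb => by rw [hD, hE, hb, hv])

lemma tangent_base_apply {P : RealPoints B} {D : B →ₗ[ℝ] ℝ} (hD : D ∈ P.tangentSpace) :
    P.ev (u e) * D (v e) + P.ev (v e) * D (u e) = D (base e f) := by
  rw [← u_mul_v e, hD]

/-- The tangent space of the suspension is cut out by `u dv + v du = df`. -/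
lemma exists_tangent (P : RealPoints B) {D : A →ₗ[ℝ] ℝ}
    (hD : D ∈ (P.comap (base e)).tangentSpace) (a b : ℝ)
    (h : P.ev (u e) * b + P.ev (v e) * a = D f) :
    ∃ E ∈ P.tangentSpace, (∀ x, E (base e x) = D x) ∧ E (u e) = a ∧ E (v e) = b := by
  have hrel : (TrivSqZeroExt.inl (P.ev (u e)) + TrivSqZeroExt.inr a : DualNumber ℝ) *
      (TrivSqZeroExt.inl (P.ev (v e)) + TrivSqZeroExt.inr b) =
      (P.comap (base e)).tangentHom D hD f := by
    ext
    · simpa using ev_u_mul_ev_v e P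
    · simpa [TrivSqZeroExt.snd_mul, mul_comm] using h
  let g := lift e _ _ _ hrel
  have hb : ∀ x, g (base e x) = (P.comap (base e)).tangentHom D hD x := fun x => lift_base ..
  have hu : g (u e) = _ := lift_u ..
  have hv : g (v e) = _ := lift_v ..
  refine ⟨_, P.snd_comp_mem_tangentSpace g ?_, ?_, ?_, ?_⟩
  · have : (TrivSqZeroExt.fstHom ℝ ℝ ℝ).comp g = P.ev :=
      hom_ext e (by simp [hb, RealPoints.comap_ev]) (by simp [hu]) (by simp [hv])
    exact fun b => congrArg (fun k : B →ₐ[ℝ] ℝ => k b) this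
  · intro x
    simp [hb]
  · simp [hu]
  · simp [hv]

/-- The coordinates `(dx, du, dv)` of a tangent vector of the suspension. -/
noncomputable def tangentCoord (P : RealPoints B) :
    P.tangentSpace →ₗ[ℝ] (P.comap (base e)).tangentSpace × ℝ × ℝ where
  toFun D := (⟨_, RealPoints.comp_mem_tangentSpace_comap (base e) D.2⟩, D.1 (u e), D.1 (v e))
  map_add' _ _ := rfl
  map_smul' _ _ := rfl

/-- The linear form `u dv + v du - df`. -/
noncomputable def tangentForm (P : RealPoints B) :
    (P.comap (base e)).tangentSpace × ℝ × ℝ →ₗ[ℝ] ℝ where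
  toFun D := P.ev (u e) * D.2.2 + P.ev (v e) * D.2.1 - D.1.1 f
  map_add' D E := by simp; ring
  map_smul' c D := by simp; ring

lemma finrank_tangentSpace (P : RealPoints B) :
    Module.finrank ℝ P.tangentSpace = Module.finrank ℝ (LinearMap.ker (tangentForm e P)) := by
  have hinj : Function.Injective (tangentCoord e P) := by
    intro D E h
    simp only [tangentCoord, LinearMap.coe_mk, AddHom.coe_mk, Prod.mk.injEq,
      Subtype.mk.injEq] at h
    exact Subtype.ext (tangent_ext e D.2 E.2 (fun a => congrArg (fun k => k a) h.1) h.2.1 h.2.2)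
  have hrange : LinearMap.range (tangentCoord e P) = LinearMap.ker (tangentForm e P) := by
    ext ⟨D, a, b⟩
    rw [LinearMap.mem_ker]
    constructor
    · rintro ⟨E, hE⟩
      rw [← hE]
      exact sub_eq_zero.mpr (tangent_base_apply e E.2)
    · intro h
      obtain ⟨E, hE, hb, hu, hv⟩ := exists_tangent e P D.2 a b (sub_eq_zero.mp h)
      exact ⟨⟨E, hE⟩, Prod.ext (Subtype.ext (LinearMap.ext hb)) (Prod.ext hu hv)⟩
  rw [← LinearMap.finrank_range_of_inj hinj, hrange]

/-- A point of the suspension is smooth if and only if it lies over a smooth point of the base and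
is not a critical point of `uv - f`. -/
theorem mem_regularLocus_iff [IsDomain A] [Algebra.FiniteType ℝ A] (hf : f ≠ 0)
    (P : RealPoints B) :
    P ∈ regularLocus B ↔ P.comap (base e) ∈ regularLocus A ∧
      (P.ev (u e) ≠ 0 ∨ P.ev (v e) ≠ 0 ∨ ∃ D ∈ (P.comap (base e)).tangentSpace, D f ≠ 0) := by
  have hrank := LinearMap.finrank_range_add_finrank_ker (K := ℝ)
    (V := (P.comap (base e)).tangentSpace × ℝ × ℝ) (V₂ := ℝ) (tangentForm e P)
  rw [← finrank_tangentSpace, Module.finrank_prod, Module.finrank_prod, Module.finrank_self]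
    at hrank
  have hdim := ringKrullDim_eq e hf
  have hle := (P.comap (base e)).ringKrullDim_le_finrank_tangentSpace
  have hB : P ∈ regularLocus B ↔ (Module.finrank ℝ P.tangentSpace : WithBot ℕ∞) =
    ringKrullDim B := Iff.rfl
  have hA : P.comap (base e) ∈ regularLocus A ↔
    (Module.finrank ℝ (P.comap (base e)).tangentSpace : WithBot ℕ∞) = ringKrullDim A := Iff.rfl
  rw [hA, hB, hdim]
  by_cases h : P.ev (u e) ≠ 0 ∨ P.ev (v e) ≠ 0 ∨ ∃ D ∈ (P.comap (base e)).tangentSpace, D f ≠ 0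
  · have hsurj : tangentForm e P ≠ 0 := by
      intro h0
      have h1 := fun D => congrArg (fun k => k D) h0
      rcases h with h | h | ⟨D, hD, h⟩
      · exact h (by simpa [tangentForm] using h1 (0, 0, 1))
      · exact h (by simpa [tangentForm] using h1 (0, 1, 0))
      · exact h (by simpa [tangentForm] using h1 (⟨D, hD⟩, 0, 0))
    rw [LinearMap.range_eq_top.mpr (LinearMap.surjective hsurj), finrank_top, Module.finrank_self]
      at hrank
    have : Module.finrank ℝ P.tangentSpace =
      Module.finrank ℝ (P.comap (base e)).tangentSpace + 1 := by omega
    rw [this, and_iff_left h]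
    push_cast
    exact ENat.WithBot.add_one_cancel
  · -- here the tangent space is too big, because the one of the base is at least `dim X`
    have hzero : tangentForm e P = 0 := by
      push Not at h
      refine LinearMap.ext fun D => ?_
      simp [tangentForm, h.1, h.2.1, h.2.2 _ D.1.2]
    rw [hzero, LinearMap.range_zero, finrank_bot] at hrank
    refine iff_of_false (fun h1 => ?_) fun h1 => h h1.2
    have : Module.finrank ℝ P.tangentSpace =
      Module.finrank ℝ (P.comap (base e)).tangentSpace + 1 + 1 := by omega
    rw [this, Nat.cast_add, Nat.cast_one] at h1
    rw [ENat.WithBot.add_one_cancel.mp h1.symm] at hle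
    norm_cast at hle
    omega

end Suspension

/-! ### Lifting flows to a suspension -/

namespace Suspension

section LiftFlow

variable {A B : Type u} [CommRing A] [Algebra ℝ A] [CommRing B] [Algebra ℝ B] {f : A}
  (e : B ≃ₐ[ℝ] Suspension A f) (F : AlgebraicFlow A) (q : ℝ[X])

lemma evalRingHom_comp_C {R : Type*} [CommRing R] (r : R) :
    (evalRingHom r).comp C = RingHom.id R := by
  ext
  simp

/-- The speed `v q(v)` at which a flow of the base is lifted to the suspension. -/
noncomputable def speed : B := v e * aeval (v e) q

lemma ev_speed (P : RealPoints B) : P.ev (speed e q) = P.ev (v e) * q.eval (P.ev (v e)) := by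
  rw [speed, map_mul, ← aeval_algHom_apply, coe_aeval_eq_eval]

/-- The coaction of a flow of the base, with the time multiplied by the speed `v q(v)`. -/
noncomputable def liftBase : A →ₐ[ℝ] B[X] :=
  (eval₂AlgHom (CAlgHom.comp (base e)) (C (speed e q) * X) fun _ => Commute.all _ _).comp
    F.coaction

lemma liftBase_apply (a : A) : liftBase e F q a =
    (F.coaction a).eval₂ (C.comp (base e).toRingHom) (C (speed e q) * X) := rfl

lemma coeff_eval₂_C_mul_X (p : A[X]) (w : B) (n : ℕ) :
    (p.eval₂ (C.comp (base e).toRingHom) (C w * X)).coeff n = base e (p.coeff n) * w ^ n := by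
  induction p using Polynomial.induction_on' with
  | add p r hp hr => rw [eval₂_add, coeff_add, hp, hr, coeff_add, map_add, add_mul]
  | monomial k a =>
    rw [eval₂_monomial, mul_pow, ← C_pow, RingHom.comp_apply, ← mul_assoc, ← C_mul,
      coeff_C_mul_X_pow, coeff_monomial]
    by_cases h : k = n
    · simp [h]
    · simp [h, Ne.symm h]

/-- The coaction of the lifted flow. It fixes `v`, and the condition that it respects the relation
`uv = f` determines its value at `u`. -/
noncomputable def liftCoaction : B →ₐ[ℝ] B[X] :=
  lift e (liftBase e F q)
    (C (u e) + C (aeval (v e) q) * X *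
      (F.coaction f).divX.eval₂ (C.comp (base e).toRingHom) (C (speed e q) * X)) (C (v e)) <| by
    rw [liftBase_apply]
    conv_rhs => rw [← divX_mul_X_add (F.coaction f)]
    rw [eval₂_add, eval₂_mul, eval₂_X, eval₂_C, F.coaction_coeff_zero, RingHom.comp_apply,
      AlgHom.toRingHom_eq_coe, RingHom.coe_coe, ← u_mul_v, speed, C_mul, C_mul]
    ring

/-- The homomorphism given by the lifted flow at the time `t`. -/
noncomputable def liftHom (t : ℝ) : B →ₐ[ℝ] B :=
  ((aeval (algebraMap ℝ B t) : B[X] →ₐ[B] B).restrictScalars ℝ).comp (liftCoaction e F q)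

lemma liftHom_apply (t : ℝ) (b : B) :
    liftHom e F q t b = (liftCoaction e F q b).eval (algebraMap ℝ B t) :=
  (congrFun (coe_aeval_eq_eval (algebraMap ℝ B t)) _).trans rfl

lemma liftHom_base (t : ℝ) (a : A) : liftHom e F q t (base e a) =
    (F.coaction a).eval₂ (base e).toRingHom (speed e q * algebraMap ℝ B t) := by
  rw [liftHom_apply, liftCoaction, lift_base, liftBase_apply, ← coe_evalRingHom, hom_eval₂,
    ← RingHom.comp_assoc, evalRingHom_comp_C, RingHom.id_comp]
  simp

lemma liftHom_v (t : ℝ) : liftHom e F q t (v e) = v e := by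
  rw [liftHom_apply, liftCoaction, lift_v, eval_C]

lemma liftHom_u (t : ℝ) : liftHom e F q t (u e) = u e + aeval (v e) q * algebraMap ℝ B t *
    (F.coaction f).divX.eval₂ (base e).toRingHom (speed e q * algebraMap ℝ B t) := by
  rw [liftHom_apply, liftCoaction, lift_u, ← coe_evalRingHom, map_add, map_mul, hom_eval₂,
    ← RingHom.comp_assoc, evalRingHom_comp_C, RingHom.id_comp]
  simp

lemma liftHom_speed (t : ℝ) : liftHom e F q t (speed e q) = speed e q := by
  rw [speed, map_mul, liftHom_v, ← aeval_algHom_apply, liftHom_v]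

lemma liftHom_zero : liftHom e F q 0 = AlgHom.id ℝ B :=
  hom_ext e
    (fun a => by
      rw [liftHom_base, map_zero, mul_zero, eval₂_at_zero, F.coaction_coeff_zero]
      rfl)
    (by simp [liftHom_u]) (by simp [liftHom_v])

variable [IsDomain A] [IsDomain B]

lemma liftHom_add (s t : ℝ) :
    liftHom e F q (s + t) = (liftHom e F q s).comp (liftHom e F q t) := by
  have hbase : ∀ a, liftHom e F q (s + t) (base e a) =
      liftHom e F q s (liftHom e F q t (base e a)) := by
    intro a
    have h := hom_eval₂ (F.coaction a) (base e).toRingHom (liftHom e F q s).toRingHom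
      (speed e q * algebraMap ℝ B t)
    have h1 : (liftHom e F q s).toRingHom.comp (base e).toRingHom =
        (eval₂RingHom (base e).toRingHom (speed e q * algebraMap ℝ B s)).comp
          F.coaction.toRingHom := RingHom.ext fun a => liftHom_base e F q s a
    have h2 : (liftHom e F q s).toRingHom (speed e q * algebraMap ℝ B t) =
        speed e q * algebraMap ℝ B t := by
      change liftHom e F q s _ = _
      rw [map_mul, liftHom_speed, AlgHom.commutes]
    rw [h1, h2, F.eval₂_eval₂_coaction, ← mul_add, ← map_add] at h
    rw [liftHom_base, liftHom_base, ← h]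
    rfl
  refine hom_ext e hbase ?_ (by simp [liftHom_v])
  -- both sides agree after multiplication by `v`, which is not a zero divisor
  refine mul_right_cancel₀ (v_ne_zero e) ?_
  have h := hbase f
  rw [← u_mul_v, map_mul, map_mul, map_mul] at h
  simpa only [liftHom_v, AlgHom.comp_apply] using h

/-- The flow of the suspension that lifts the flow `F` of the base with the speed `v q(v)`; it
preserves the coordinate `v`. -/
noncomputable def liftFlow : AlgebraicFlow B where
  toHom :=
    { toFun := fun t => AlgEquiv.ofAlgHom (liftHom e F q t.toAdd) (liftHom e F q (-t.toAdd))
        (by rw [← liftHom_add, add_neg_cancel, liftHom_zero])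
        (by rw [← liftHom_add, neg_add_cancel, liftHom_zero])
      map_one' := AlgEquiv.ext fun b => congrArg (fun h => h b) (liftHom_zero e F q)
      map_mul' := fun s t => AlgEquiv.ext fun b =>
        congrArg (fun h => h b) (liftHom_add e F q s.toAdd t.toAdd) }
  coaction := liftCoaction e F q
  toHom_apply t b := liftHom_apply e F q t b

lemma liftFlow_smul_ev (t : ℝ) (P : RealPoints B) (b : B) :
    ((liftFlow e F q).aut t • P).ev b = P.ev (liftHom e F q (-t) b) := by
  rw [RealPoints.smul_ev, ← AlgebraicFlow.aut_neg]
  rfl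

lemma liftFlow_smul_v (t : ℝ) (P : RealPoints B) :
    ((liftFlow e F q).aut t • P).ev (v e) = P.ev (v e) := by
  rw [liftFlow_smul_ev, liftHom_v]

lemma liftFlow_smul_comap (t : ℝ) (P : RealPoints B) :
    ((liftFlow e F q).aut t • P).comap (base e) =
      F.aut (P.ev (v e) * q.eval (P.ev (v e)) * t) • P.comap (base e) := by
  refine RealPoints.ext_ev fun a => ?_
  have h := hom_eval₂ (F.coaction a) (base e).toRingHom P.ev.toRingHom
      (speed e q * algebraMap ℝ B (-t))
  rw [RealPoints.comap_ev, liftFlow_smul_ev, liftHom_base, F.aut_smul_ev, eval_map]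
  refine h.trans ?_
  congr 1
  change P.ev _ = _
  rw [map_mul, ev_speed, AlgHom.commutes]
  simp

/-- On the hypersurface `v = 0` a lifted flow translates the coordinate `u`. -/
lemma liftFlow_smul_u (t : ℝ) (P : RealPoints B) (hP : P.ev (v e) = 0) :
    ((liftFlow e F q).aut t • P).ev (u e) =
      P.ev (u e) + t * q.eval 0 * F.velocity (P.comap (base e)) f := by
  have h := hom_eval₂ (F.coaction f).divX (base e).toRingHom P.ev.toRingHom
      (speed e q * algebraMap ℝ B (-t))
  have h2 : P.ev.toRingHom (speed e q * algebraMap ℝ B (-t)) = 0 := by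
    change P.ev _ = _
    rw [map_mul, ev_speed, hP, zero_mul, zero_mul]
  rw [h2, eval₂_at_zero, coeff_divX] at h
  rw [liftFlow_smul_ev, liftHom_u, map_add, map_mul, map_mul, ← aeval_algHom_apply,
    coe_aeval_eq_eval, hP, AlgHom.commutes, F.velocity_apply]
  refine congrArg₂ (· + ·) rfl ?_
  change P.ev ((F.coaction f).divX.eval₂ (base e).toRingHom (speed e q * algebraMap ℝ B (-t))) =
    P.ev (base e (F.generator f)) at h
  rw [h, RealPoints.comap_ev, Algebra.algebraMap_self_apply]
  ring

lemma liftFlow_velocity_base (P : RealPoints B) (a : A) :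
    (liftFlow e F q).velocity P (base e a) =
      P.ev (v e) * q.eval (P.ev (v e)) * F.velocity (P.comap (base e)) a := by
  change -P.ev ((liftCoaction e F q (base e a)).coeff 1) = _
  rw [liftCoaction, lift_base, liftBase_apply, coeff_eval₂_C_mul_X, pow_one, map_mul, ev_speed,
    F.velocity_apply, RealPoints.comap_ev, AlgebraicFlow.generator]
  ring

lemma liftFlow_velocity_u (P : RealPoints B) :
    (liftFlow e F q).velocity P (u e) =
      q.eval (P.ev (v e)) * F.velocity (P.comap (base e)) f := by
  change -P.ev ((liftCoaction e F q (u e)).coeff 1) = _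
  rw [liftCoaction, lift_u, coeff_add, coeff_C_succ, zero_add, mul_assoc, coeff_C_mul,
    coeff_X_mul, coeff_eval₂_C_mul_X, coeff_divX, pow_zero, mul_one, map_mul,
    ← aeval_algHom_apply, coe_aeval_eq_eval, F.velocity_apply, RealPoints.comap_ev,
    AlgebraicFlow.generator]
  ring

lemma liftFlow_velocity_v (P : RealPoints B) : (liftFlow e F q).velocity P (v e) = 0 := by
  change -P.ev ((liftCoaction e F q (v e)).coeff 1) = _
  rw [liftCoaction, lift_v, coeff_C_succ, map_zero, neg_zero]

end LiftFlow

end Suspension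

/-! ### Transitivity on a suspension -/

lemma SAutIsMTransitive.exists_smul_eq {A : Type u} [CommRing A] [Algebra ℝ A]
    (h : ∀ m, SAutIsMTransitive A m) {J : Type*} [Finite J] {a b : J → RealPoints A}
    (ha : Function.Injective a) (hb : Function.Injective b) (ha' : ∀ j, a j ∈ regularLocus A)
    (hb' : ∀ j, b j ∈ regularLocus A) : ∃ g ∈ SAut A, ∀ j, g • a j = b j := by
  have s := (Finite.equivFin J).symm
  obtain ⟨g, hg, h⟩ := h _ (a ∘ s) (b ∘ s) (ha.comp s.injective) (hb.comp s.injective)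
    (fun _ => ha' _) fun _ => hb' _
  exact ⟨g, hg, fun j => by simpa using h (s.symm j)⟩

/-- At a flexible point where `df ≠ 0`, some flow moves the value of `f`. -/
lemma IsFlexiblePoint.exists_velocity_ne_zero {A : Type u} [CommRing A] [Algebra ℝ A] [IsDomain A]
    {x : RealPoints A} (hx : IsFlexiblePoint x) {f : A} (hf : ∃ D ∈ x.tangentSpace, D f ≠ 0) :
    ∃ F : AlgebraicFlow A, F.velocity x f ≠ 0 := by
  by_contra! H
  obtain ⟨D, hD, hDf⟩ := hf
  refine hDf ?_
  rw [← hx] at hD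
  refine Submodule.span_le (p := LinearMap.ker (LinearMap.applyₗ f)).mpr ?_ hD
  intro E hE
  obtain ⟨F, rfl⟩ := AlgebraicFlow.exists_velocity_eq hE
  exact H F

lemma Polynomial.exists_eval_eq_of_notMem {c : ℝ} {S : Finset ℝ} (hc : c ∉ S) (r : ℝ) :
    ∃ q : ℝ[X], q.eval c = r ∧ ∀ s ∈ S, q.eval s = 0 := by
  have h0 : ∏ s ∈ S, (c - s) ≠ 0 :=
    Finset.prod_ne_zero_iff.mpr fun s hs => sub_ne_zero.mpr fun h => hc (h ▸ hs)
  refine ⟨C (r / ∏ s ∈ S, (c - s)) * ∏ s ∈ S, (X - C s), ?_, fun s hs => ?_⟩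
  · simp [eval_prod, h0]
  · have : ∏ c ∈ S, (X - C c).eval s = 0 := Finset.prod_eq_zero hs (by simp)
    rw [eval_mul, eval_prod, this, mul_zero]

namespace Suspension

section Transitivity

variable {A B : Type u} [CommRing A] [Algebra ℝ A] [CommRing B] [Algebra ℝ B] {f : A}
  (e : B ≃ₐ[ℝ] Suspension A f)

lemma point_ext_of_v_ne_zero {P Q : RealPoints B} (hbase : P.comap (base e) = Q.comap (base e))
    (hv : P.ev (v e) = Q.ev (v e)) (h0 : P.ev (v e) ≠ 0) : P = Q := by
  refine point_ext e hbase (mul_right_cancel₀ h0 ?_) hv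
  conv_rhs => rw [hv]
  rw [ev_u_mul_ev_v, ev_u_mul_ev_v, hbase]

variable [IsDomain A] [IsDomain B]

/-- Special automorphisms of the base act on a level hypersurface `v = c`, `c ≠ 0`, of the
suspension, by special automorphisms that are trivial on finitely many other levels. -/
lemma exists_lift_SAut {g : A ≃ₐ[ℝ] A} (hg : g ∈ SAut A) {c : ℝ} (hc : c ≠ 0) (S : Finset ℝ) :
    ∃ g' ∈ SAut B, ∀ P : RealPoints B, (g' • P).ev (v e) = P.ev (v e) ∧
      (P.ev (v e) = c → (g' • P).comap (base e) = g • P.comap (base e)) ∧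
      (P.ev (v e) ∈ S → P.ev (v e) ≠ c → g' • P = P) := by
  classical
  refine AlgebraicFlow.SAut_induction hg (fun F t => ?_) ?_ ?_
  · -- the lift has speed `1` on the level `c` and speed `0` on the other levels
    obtain ⟨q, hqc, hqS⟩ := Polynomial.exists_eval_eq_of_notMem
      (c := c) (S := insert 0 (S.erase c)) (by simp [hc]) c⁻¹
    refine ⟨_, (liftFlow e F q).aut_mem_SAut t, fun P => ⟨liftFlow_smul_v .., fun h => ?_,
      fun hS hPc => ?_⟩⟩
    · rw [liftFlow_smul_comap, h, hqc, mul_inv_cancel₀ hc, one_mul]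
    · have hq := hqS _ (Finset.mem_insert_of_mem (Finset.mem_erase.mpr ⟨hPc, hS⟩))
      have hbase : ((liftFlow e F q).aut t • P).comap (base e) = P.comap (base e) := by
        rw [liftFlow_smul_comap, hq, mul_zero, zero_mul, F.aut_zero, one_smul]
      by_cases h0 : P.ev (v e) = 0
      · refine point_ext e hbase ?_ (liftFlow_smul_v ..)
        rw [liftFlow_smul_u _ _ _ _ _ h0, hqS 0 (Finset.mem_insert_self ..)]
        simp
      · exact (point_ext_of_v_ne_zero e hbase.symm (liftFlow_smul_v ..).symm h0).symm
  · exact ⟨1, one_mem _, fun P => by simp⟩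
  · rintro g h ⟨g', hg', Hg⟩ ⟨h', hh', Hh⟩
    refine ⟨g' * h', mul_mem hg' hh', fun P => ?_⟩
    obtain ⟨h1, h2, h3⟩ := Hh P
    obtain ⟨g1, g2, g3⟩ := Hg (h' • P)
    rw [mul_smul, mul_smul]
    refine ⟨g1.trans h1, fun hP => ?_, fun hS hP => ?_⟩
    · rw [g2 (h1.trans hP), h2 hP]
    · rw [g3 (h1 ▸ hS) (h1 ▸ hP), h3 hS hP]

/-- Preserving the coordinate `v`, special automorphisms move the points of a finite set outside
the hypersurface `v = 0` over arbitrary smooth points of the base, distinct on each level of `v`. -/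
lemma exists_SAut_comap_eq (htrans : ∀ m, SAutIsMTransitive A m) {m : ℕ}
    {P : Fin m → RealPoints B} (hP : Function.Injective P)
    (hreg : ∀ i, (P i).comap (base e) ∈ regularLocus A) {y : Fin m → RealPoints A}
    (hy : ∀ i, y i ∈ regularLocus A)
    (hyP : ∀ i j, (P i).ev (v e) ≠ 0 → (P i).ev (v e) = (P j).ev (v e) → y i = y j → i = j) :
    ∃ g ∈ SAut B, ∀ i, (g • P i).ev (v e) = (P i).ev (v e) ∧
      ((P i).ev (v e) ≠ 0 → (g • P i).comap (base e) = y i) ∧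
      ((P i).ev (v e) = 0 → g • P i = P i) := by
  classical
  -- the levels of `v` are treated one after the other
  suffices H : ∀ T : Finset ℝ, ∃ g ∈ SAut B, ∀ i, (g • P i).ev (v e) = (P i).ev (v e) ∧
      ((P i).ev (v e) ∈ T → (P i).ev (v e) ≠ 0 → (g • P i).comap (base e) = y i) ∧
      (((P i).ev (v e) ∉ T ∨ (P i).ev (v e) = 0) → g • P i = P i) by
    obtain ⟨g, hg, h⟩ := H (Finset.univ.image fun i => (P i).ev (v e))
    exact ⟨g, hg, fun i => ⟨(h i).1, (h i).2.1 (Finset.mem_image_of_mem _ (Finset.mem_univ i)),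
      fun h0 => (h i).2.2 (.inr h0)⟩⟩
  intro T
  induction T using Finset.induction_on with
  | empty => exact ⟨1, one_mem _, fun i => by simp⟩
  | insert c T hcT ih =>
    obtain ⟨g, hg, h⟩ := ih
    by_cases hc : c = 0
    · refine ⟨g, hg, fun i => ⟨(h i).1, fun hi h0 => (h i).2.1 ?_ h0, fun hi => (h i).2.2 ?_⟩⟩
      · exact (Finset.mem_insert.mp hi).resolve_left fun h1 => h0 (h1.trans hc)
      · exact hi.imp (fun h1 h2 => h1 (Finset.mem_insert_of_mem h2)) id
    let J := {i // (P i).ev (v e) = c}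
    obtain ⟨k, hk, hkJ⟩ := SAutIsMTransitive.exists_smul_eq htrans (J := J)
      (a := fun i => (P i).comap (base e)) (b := fun i => y i)
      (fun i j hij => Subtype.ext (hP (point_ext_of_v_ne_zero e hij (i.2.trans j.2.symm)
        (i.2.trans_ne hc))))
      (fun i j hij => Subtype.ext (hyP i j (i.2.trans_ne hc) (i.2.trans j.2.symm) hij))
      (fun i => hreg i) fun i => hy i
    obtain ⟨k', hk', hkP⟩ := exists_lift_SAut e hk hc
      (Finset.univ.image fun i => (P i).ev (v e))
    refine ⟨k' * g, mul_mem hk' hg, fun i => ?_⟩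
    obtain ⟨h1, h2, h3⟩ := h i
    obtain ⟨k1, k2, k3⟩ := hkP (g • P i)
    rw [h1] at k1 k2 k3
    have hS : (P i).ev (v e) ∈ Finset.univ.image fun i => (P i).ev (v e) :=
      Finset.mem_image_of_mem _ (Finset.mem_univ i)
    rw [mul_smul]
    refine ⟨k1, fun hi h0 => ?_, fun hi => ?_⟩
    · by_cases hic : (P i).ev (v e) = c
      · rw [k2 hic, h3 (.inl (hic ▸ hcT))]
        exact hkJ ⟨i, hic⟩
      · rw [k3 hS hic]
        exact h2 ((Finset.mem_insert.mp hi).resolve_left hic) h0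
    · have hic : (P i).ev (v e) ≠ c := by
        rintro rfl
        exact hi.elim (fun h => h (Finset.mem_insert_self ..)) hc
      rw [k3 hS hic, h3 (hi.imp (fun h1 h2 => h1 (Finset.mem_insert_of_mem h2)) id)]

/-- Special automorphisms move finitely many smooth points away from `u = v = 0`. -/
lemma exists_SAut_ne_zero [Algebra.FiniteType ℝ A] (hf : f ≠ 0) (hflex : IsFlexible A) {m : ℕ}
    (P : Fin m → RealPoints B) (hreg : ∀ i, P i ∈ regularLocus B) :
    ∃ g ∈ SAut B, ∀ i, (g • P i).ev (u e) ≠ 0 ∨ (g • P i).ev (v e) ≠ 0 := by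
  classical
  -- induction on the number of points with `u = v = 0`
  obtain ⟨n, hn⟩ : ∃ n, (Finset.univ.filter fun i =>
    (P i).ev (u e) = 0 ∧ (P i).ev (v e) = 0).card ≤ n := ⟨_, le_rfl⟩
  induction n generalizing P with
  | zero =>
    refine ⟨1, one_mem _, fun i => ?_⟩
    rw [one_smul, ← not_and_or]
    intro hi
    have := Finset.card_eq_zero.mp (Nat.le_zero.mp hn)
    exact Finset.notMem_empty i (this ▸ Finset.mem_filter.mpr ⟨Finset.mem_univ i, hi⟩)
  | succ n ih =>
    by_cases H : ∃ i, (P i).ev (u e) = 0 ∧ (P i).ev (v e) = 0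
    swap
    · push Not at H
      refine ⟨1, one_mem _, fun i => ?_⟩
      rw [one_smul]
      exact or_iff_not_imp_left.mpr fun h => H i (not_not.mp h)
    obtain ⟨i₀, hu₀, hv₀⟩ := H
    obtain ⟨hx, hcrit⟩ := (mem_regularLocus_iff e hf (P i₀)).mp (hreg i₀)
    obtain ⟨F, hF⟩ := (hflex _ hx).exists_velocity_ne_zero
      ((hcrit.resolve_left (not_not.mpr hu₀)).resolve_left (not_not.mpr hv₀))
    -- a generic time keeps the nonzero values of `v` on `u = 0` nonzero
    obtain ⟨t, ht⟩ := Infinite.exists_notMem_finset (insert 0 (Finset.univ.image fun i =>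
      -(P i).ev (v e) / F.velocity ((P i).comap (base e)) f))
    rw [Finset.mem_insert, not_or] at ht
    obtain ⟨ht0, ht⟩ := ht
    let k := (liftFlow (swap e) F 1).aut t
    have hku : ∀ i, (k • P i).ev (u e) = (P i).ev (u e) := fun i => by
      simpa using liftFlow_smul_v (swap e) F 1 t (P i)
    have hkv : ∀ i, (P i).ev (u e) = 0 → (k • P i).ev (v e) =
        (P i).ev (v e) + t * F.velocity ((P i).comap (base e)) f := fun i hi => by
      simpa using liftFlow_smul_u (swap e) F 1 t (P i) (by simpa using hi)
    obtain ⟨g, hg, h⟩ := ih (fun i => k • P i)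
      (fun i => RealPoints.smul_mem_regularLocus k (hreg i)) <| by
      refine Nat.le_of_lt_succ ((Finset.card_lt_card ?_).trans_le hn)
      refine Finset.ssubset_iff_of_subset ?_ |>.mpr ⟨i₀, by simp [hu₀, hv₀], ?_⟩
      · intro i hi
        simp only [Finset.mem_filter, Finset.mem_univ, true_and, hku] at hi ⊢
        refine ⟨hi.1, ?_⟩
        by_contra hvi
        rw [hkv i hi.1] at hi
        refine ht (Finset.mem_image.mpr ⟨i, Finset.mem_univ i, ?_⟩)
        have hne : F.velocity ((P i).comap (base e)) f ≠ 0 := fun h => by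
          rw [h, mul_zero, add_zero] at hi
          exact hvi hi.2
        rw [div_eq_iff hne]
        linarith [hi.2]
      · simp [hku, hkv i₀ hu₀, hu₀, hv₀, ht0, hF]
    exact ⟨g * k, mul_mem hg ((liftFlow (swap e) F 1).aut_mem_SAut t),
      fun i => by rw [mul_smul]; exact h i⟩

/-- Special automorphisms move any finite family of distinct smooth points to the points
`(yᵢ, i + 1, i + 1)`; the values `i + 1` serve as distinct nonzero real numbers. -/
lemma exists_SAut_standard [Algebra.FiniteType ℝ A] (hf : f ≠ 0) (hflex : IsFlexible A)
    (htrans : ∀ m, SAutIsMTransitive A m)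
    (hsurj : (fun x : RealPoints A => x.ev f) '' regularLocus A = Set.univ) {m : ℕ}
    {P : Fin m → RealPoints B} (hP : Function.Injective P) (hreg : ∀ i, P i ∈ regularLocus B)
    {y : Fin m → RealPoints A} (hy : ∀ i, y i ∈ regularLocus A)
    (hyf : ∀ i, (y i).ev f = ((i : ℝ) + 1) * (i + 1)) :
    ∃ g ∈ SAut B, ∀ i, (g • P i).comap (base e) = y i ∧ (g • P i).ev (u e) = i + 1 ∧
      (g • P i).ev (v e) = i + 1 := by
  have hpos : ∀ i : Fin m, (i : ℝ) + 1 ≠ 0 := fun i => by positivity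
  have hinj : ∀ i j : Fin m, (i : ℝ) + 1 = j + 1 → i = j := fun i j h => by
    ext
    exact_mod_cast add_right_cancel h
  have hbase : ∀ (g : B ≃ₐ[ℝ] B) i, (g • P i).comap (base e) ∈ regularLocus A := fun g i =>
    ((mem_regularLocus_iff e hf _).mp (RealPoints.smul_mem_regularLocus g (hreg i))).1
  choose z hz hzf using fun r : ℝ => (hsurj.symm ▸ Set.mem_univ r :
    r ∈ (fun x : RealPoints A => x.ev f) '' regularLocus A)
  have hzf : ∀ r, (z r).ev f = r := hzf
  -- make `(u, v) ≠ 0` everywhere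
  obtain ⟨g₁, hg₁, h₁⟩ := exists_SAut_ne_zero e hf hflex P hreg
  -- make `v ≠ 0` everywhere, preserving `u`
  obtain ⟨g₂, hg₂, h₂⟩ := exists_SAut_comap_eq (swap e) htrans
    (P := fun i => g₁ • P i) (fun i j h => hP (MulAction.injective g₁ h))
    (by simpa using hbase g₁) (y := fun i => z ((g₁ • P i).ev (u e) * (i + 1)))
    (fun i => hz _) fun i j h0 h h' => by
      have := congrArg (fun x : RealPoints A => x.ev f) h'
      simp only [hzf] at this
      rw [v_swap] at h h0
      rw [← h] at this
      exact hinj i j (mul_left_cancel₀ h0 this)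
  simp only [← mul_smul, v_swap, base_swap] at h₂
  have hv₂ : ∀ i, ((g₂ * g₁) • P i).ev (v e) ≠ 0 := by
    intro i
    obtain ⟨hu, hne, heq⟩ := h₂ i
    by_cases h0 : (g₁ • P i).ev (u e) = 0
    · rw [heq h0]
      exact (h₁ i).resolve_left (not_not.mpr h0)
    · have := ev_u_mul_ev_v e ((g₂ * g₁) • P i)
      rw [hne h0, hu, hzf] at this
      rw [mul_left_cancel₀ h0 this]
      exact hpos i
  -- make `u = i + 1`, preserving `v`
  obtain ⟨g₃, hg₃, h₃⟩ := exists_SAut_comap_eq e htrans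
    (P := fun i => (g₂ * g₁) • P i) (fun i j h => hP (MulAction.injective (g₂ * g₁) h))
    (hbase (g₂ * g₁)) (y := fun i => z ((i + 1) * ((g₂ * g₁) • P i).ev (v e)))
    (fun i => hz _) fun i j h0 h h' => by
      have := congrArg (fun x : RealPoints A => x.ev f) h'
      simp only [hzf] at this
      rw [← h] at this
      exact hinj i j (mul_right_cancel₀ h0 this)
  simp only [← mul_smul] at h₃
  have hu₃ : ∀ i, ((g₃ * (g₂ * g₁)) • P i).ev (u e) = i + 1 := by
    intro i
    obtain ⟨hv, hne, -⟩ := h₃ i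
    have := ev_u_mul_ev_v e ((g₃ * (g₂ * g₁)) • P i)
    rw [hne (hv₂ i), hv, hzf] at this
    exact mul_right_cancel₀ (hv₂ i) this
  -- the values of `u` are now distinct, so that the base points can be chosen freely
  obtain ⟨g₄, hg₄, h₄⟩ := exists_SAut_comap_eq (swap e) htrans
    (P := fun i => (g₃ * (g₂ * g₁)) • P i)
    (fun i j h => hP (MulAction.injective (g₃ * (g₂ * g₁)) h))
    (by simpa using hbase (g₃ * (g₂ * g₁))) hy fun i j h0 h h' => by
      rw [v_swap, hu₃, hu₃] at h
      exact hinj i j h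
  simp only [← mul_smul, v_swap, base_swap, hu₃] at h₄
  refine ⟨g₄ * (g₃ * (g₂ * g₁)), mul_mem hg₄ (mul_mem hg₃ (mul_mem hg₂ hg₁)), fun i => ?_⟩
  obtain ⟨hu, hne, -⟩ := h₄ i
  refine ⟨hne (hpos i), hu, ?_⟩
  have := ev_u_mul_ev_v e ((g₄ * (g₃ * (g₂ * g₁))) • P i)
  rw [hne (hpos i), hu, hyf] at this
  exact mul_left_cancel₀ (hpos i) this

include e in
/-- If the base is flexible with infinitely transitive special automorphism group, then the special
automorphism group of a suspension is infinitely transitive. -/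
theorem isMTransitive [Algebra.FiniteType ℝ A] (hf : f ≠ 0) (hflex : IsFlexible A)
    (htrans : ∀ m, SAutIsMTransitive A m)
    (hsurj : (fun x : RealPoints A => x.ev f) '' regularLocus A = Set.univ) (m : ℕ) :
    SAutIsMTransitive B m := by
  intro a b ha hb ha' hb'
  choose y hy hyf using fun i : Fin m =>
    (hsurj.symm ▸ Set.mem_univ (((i : ℝ) + 1) * (i + 1)) :
      ((i : ℝ) + 1) * (i + 1) ∈ (fun x : RealPoints A => x.ev f) '' regularLocus A)
  obtain ⟨g, hg, h⟩ := exists_SAut_standard e hf hflex htrans hsurj ha ha' hy hyf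
  obtain ⟨k, hk, h'⟩ := exists_SAut_standard e hf hflex htrans hsurj hb hb' hy hyf
  refine ⟨k⁻¹ * g, mul_mem (inv_mem hk) hg, fun i => ?_⟩
  rw [mul_smul, inv_smul_eq_iff]
  exact point_ext e ((h i).1.trans (h' i).1.symm) ((h i).2.1.trans (h' i).2.1.symm)
    ((h i).2.2.trans (h' i).2.2.symm)

end Transitivity

end Suspension

/-! ### Flexibility of a suspension -/

section Flexible

variable {A : Type u} [CommRing A] [Algebra ℝ A]

/-- Conjugating an action by `g` transports its velocities at `x` to velocities at `g x`. -/
lemma comp_inv_mem_orbitVelocities (g : A ≃ₐ[ℝ] A) {x : RealPoints A} {D : A →ₗ[ℝ] ℝ}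
    (hD : D ∈ orbitVelocities x) :
    D ∘ₗ (g⁻¹ : A ≃ₐ[ℝ] A).toLinearMap ∈ orbitVelocities (g • x) := by
  obtain ⟨φ, hφ⟩ := hD
  refine ⟨⟨(MulAut.conj g).toMonoidHom.comp φ.toHom,
    (MulAut.conj g).injective.comp φ.effective, fun a => ?_⟩, fun a => ?_⟩
  · obtain ⟨p, hp⟩ := φ.algebraic (g⁻¹ a)
    refine ⟨p.map (g : A →+* A), fun t => ?_⟩
    change g (φ.toHom (Multiplicative.ofAdd t) (g⁻¹ a)) = _
    have h : algebraMap ℝ A t = (g : A →+* A) (algebraMap ℝ A t) := (g.commutes t).symm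
    rw [hp, h, eval_map_apply, ← h]
    rfl
  · have h : ∀ t : ℝ, (MulAut.conj g (φ.toHom (Multiplicative.ofAdd t))) • g • x =
        g • φ.toHom (Multiplicative.ofAdd t) • x := fun t => by
      rw [MulAut.conj_apply, ← mul_smul, inv_mul_cancel_right, mul_smul]
    change HasDerivAt (fun t : ℝ =>
      ((MulAut.conj g (φ.toHom (Multiplicative.ofAdd t))) • g • x).ev a) _ 0
    simp_rw [h]
    exact hφ (g⁻¹ a)

lemma isFlexiblePoint_iff_le [IsDomain A] {x : RealPoints A} :
    IsFlexiblePoint x ↔ x.tangentSpace ≤ Submodule.span ℝ (orbitVelocities x) := by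
  refine ⟨fun h => h.ge, fun h => le_antisymm (Submodule.span_le.mpr fun D hD => ?_) h⟩
  obtain ⟨F, rfl⟩ := AlgebraicFlow.exists_velocity_eq hD
  exact F.velocity_mem_tangentSpace x

lemma IsFlexiblePoint.smul [IsDomain A] (g : A ≃ₐ[ℝ] A) {x : RealPoints A}
    (hx : IsFlexiblePoint x) : IsFlexiblePoint (g • x) := by
  rw [isFlexiblePoint_iff_le]
  intro E hE
  have h : ((RealPoints.tangentSpaceSMul g x).symm ⟨E, hE⟩).1 ∈
      Submodule.span ℝ (orbitVelocities x) := by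
    rw [hx]
    exact Subtype.mem _
  have h2 : Submodule.span ℝ (orbitVelocities x) ≤
      (Submodule.span ℝ (orbitVelocities (g • x))).comap
        (LinearMap.lcomp ℝ ℝ (g⁻¹ : A ≃ₐ[ℝ] A).toLinearMap) :=
    Submodule.span_le.mpr fun D hD =>
      Submodule.subset_span (comp_inv_mem_orbitVelocities g hD)
  have h3 : ((RealPoints.tangentSpaceSMul g x).symm ⟨E, hE⟩).1 ∘ₗ
      (g⁻¹ : A ≃ₐ[ℝ] A).toLinearMap = E :=
    congrArg Subtype.val ((RealPoints.tangentSpaceSMul g x).apply_symm_apply ⟨E, hE⟩)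
  rw [← h3]
  exact h2 h

lemma AlgebraicFlow.velocity_aut_smul (F : AlgebraicFlow A) (s : ℝ) (x : RealPoints A) (a : A) :
    F.velocity (F.aut s • x) a =
      -(derivative ((F.coaction a).map x.ev.toRingHom)).eval (-s) := by
  refine (F.hasDerivAt_velocity (F.aut s • x) a).unique ?_
  simp_rw [← mul_smul, ← aut_add]
  have := F.hasDerivAt_aut_smul s x a
  rw [← zero_add s] at this
  simpa using this.comp_add_const 0 s

/-- A function that is not constant on the smooth locus has a smooth noncritical point outside its
zero set: otherwise it would be constant along all orbits. -/
lemma exists_velocity_ne_zero_of_transitive [IsDomain A] {f : A} (htrans : SAutIsMTransitive A 1)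
    (hsurj : (fun x : RealPoints A => x.ev f) '' regularLocus A = Set.univ) :
    ∃ x ∈ regularLocus A, x.ev f ≠ 0 ∧ ∃ F : AlgebraicFlow A, F.velocity x f ≠ 0 := by
  by_contra! H
  have key : ∀ g ∈ SAut A, ∀ x ∈ regularLocus A, (g • x).ev f = x.ev f := by
    intro g hg
    refine AlgebraicFlow.SAut_induction hg (fun F t x hx => ?_) (fun x _ => by rw [one_smul])
      fun g h Hg Hh x hx => ?_
    · -- the value of `f` along the orbit is a polynomial `p` in the time with `p p' = 0`
      set p := (F.coaction f).map x.ev.toRingHom with hp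
      have hpp : p * derivative p = 0 := by
        refine Polynomial.funext fun s => ?_
        rw [eval_mul, eval_zero, mul_eq_zero, or_iff_not_imp_left]
        intro hs
        have h1 := H (F.aut (-s) • x) (RealPoints.smul_mem_regularLocus _ hx)
          (by rwa [F.aut_smul_ev, neg_neg]) F
        rw [F.velocity_aut_smul, neg_neg, neg_eq_zero] at h1
        exact h1
      have hconst : ∃ c, p = C c := by
        rcases mul_eq_zero.mp hpp with h | h
        · exact ⟨0, by rw [h, C_0]⟩
        · exact ⟨_, eq_C_of_derivative_eq_zero h⟩
      obtain ⟨c, hc⟩ := hconst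
      have h0 := F.aut_smul_ev 0 x f
      rw [F.aut_zero, one_smul] at h0
      rw [F.aut_smul_ev, h0, ← hp, hc, eval_C, eval_C]
    · rw [mul_smul, Hg _ (RealPoints.smul_mem_regularLocus _ hx), Hh _ hx]
  obtain ⟨x, hx, hx1⟩ : (1 : ℝ) ∈ (fun x : RealPoints A => x.ev f) '' regularLocus A :=
    hsurj ▸ Set.mem_univ _
  obtain ⟨y, hy, hy0⟩ : (0 : ℝ) ∈ (fun x : RealPoints A => x.ev f) '' regularLocus A :=
    hsurj ▸ Set.mem_univ _
  obtain ⟨g, hg, h⟩ := htrans (fun _ => x) (fun _ => y) (Function.injective_of_subsingleton _)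
    (Function.injective_of_subsingleton _) (fun _ => hx) fun _ => hy
  have := key g hg x hx
  rw [h 0] at this
  exact zero_ne_one (hy0.symm.trans (this.trans hx1))

end Flexible

namespace Suspension

variable {A B : Type u} [CommRing A] [Algebra ℝ A] [CommRing B] [Algebra ℝ B] {f : A}
  (e : B ≃ₐ[ℝ] Suspension A f) [IsDomain A] [IsDomain B]

/-- The velocities of the lifted flows at a point of the suspension. -/
lemma exists_mem_span_orbitVelocities (P : RealPoints B) {D : A →ₗ[ℝ] ℝ}
    (hD : D ∈ Submodule.span ℝ (orbitVelocities (P.comap (base e)))) :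
    ∃ E ∈ Submodule.span ℝ (orbitVelocities P), (∀ a, E (base e a) = P.ev (v e) * D a) ∧
      E (u e) = D f ∧ E (v e) = 0 := by
  induction hD using Submodule.span_induction with
  | mem D hD =>
    obtain ⟨F, rfl⟩ := AlgebraicFlow.exists_velocity_eq hD
    exact ⟨_, (liftFlow e F 1).velocity_mem_span P,
      fun a => by rw [liftFlow_velocity_base, eval_one, mul_one],
      by rw [liftFlow_velocity_u, eval_one, one_mul], liftFlow_velocity_v e F 1 P⟩
  | zero => exact ⟨0, zero_mem _, by simp⟩
  | add D D' _ _ h h' =>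
    obtain ⟨E, hE, h1, h2, h3⟩ := h
    obtain ⟨E', hE', h1', h2', h3'⟩ := h'
    refine ⟨E + E', add_mem hE hE', fun a => ?_, ?_, ?_⟩
    · simp [h1, h1', mul_add]
    · simp [h2, h2']
    · simp [h3, h3']
  | smul c D _ h =>
    obtain ⟨E, hE, h1, h2, h3⟩ := h
    refine ⟨c • E, Submodule.smul_mem _ c hE, fun a => ?_, ?_, ?_⟩
    · simp [h1, mul_left_comm]
    · simp [h2]
    · simp [h3]

/-- A point with `u v ≠ 0` over a flexible point that is not critical for `f` is flexible. The
lifted flows that preserve `v` span the tangent space of the level of `v`, and a lifted flow that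
preserves `u` is transversal to it. -/
lemma isFlexiblePoint (P : RealPoints B) (hx : IsFlexiblePoint (P.comap (base e)))
    (hP : (P.comap (base e)).ev f ≠ 0)
    (hF : ∃ F : AlgebraicFlow A, F.velocity (P.comap (base e)) f ≠ 0) : IsFlexiblePoint P := by
  obtain ⟨F, hF⟩ := hF
  have hv : P.ev (v e) ≠ 0 := fun h => hP (by rw [← ev_u_mul_ev_v, h, mul_zero])
  let S := Submodule.span ℝ (orbitVelocities P)
  have hS : S ≤ P.tangentSpace := Submodule.span_le.mpr fun D hD => by
    obtain ⟨F, rfl⟩ := AlgebraicFlow.exists_velocity_eq hD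
    exact F.velocity_mem_tangentSpace P
  rw [isFlexiblePoint_iff_le]
  -- tangent vectors of the level of `v`
  have hlevel : ∀ E ∈ P.tangentSpace, E (v e) = 0 → E ∈ S := by
    intro E hE hEv
    have hD : E ∘ₗ (base e).toLinearMap ∈
        Submodule.span ℝ (orbitVelocities (P.comap (base e))) := by
      rw [hx]
      exact RealPoints.comp_mem_tangentSpace_comap (base e) hE
    obtain ⟨E', hE', h1, h2, h3⟩ := exists_mem_span_orbitVelocities e P hD
    have hrel := tangent_base_apply e hE
    rw [hEv, mul_zero, zero_add] at hrel
    have : E = (P.ev (v e))⁻¹ • E' := by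
      refine tangent_ext e hE (Submodule.smul_mem _ _ (hS hE')) (fun a => ?_) ?_ ?_
      · simp [h1, hv]
      · rw [LinearMap.smul_apply, h2, smul_eq_mul, LinearMap.comp_apply,
          AlgHom.toLinearMap_apply, ← hrel, inv_mul_cancel_left₀ hv]
      · simp [h3, hEv]
    rw [this]
    exact Submodule.smul_mem _ _ hE'
  intro E hE
  have hE₁ := (liftFlow (swap e) F 1).velocity_mem_span P
  have hE₁v : (liftFlow (swap e) F 1).velocity P (v e) = F.velocity (P.comap (base e)) f := by
    simpa using liftFlow_velocity_u (swap e) F 1 P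
  set E₁ := (liftFlow (swap e) F 1).velocity P
  have h : E - (E (v e) / F.velocity (P.comap (base e)) f) • E₁ ∈ S :=
    hlevel _ (sub_mem hE (Submodule.smul_mem _ _ (hS hE₁))) (by simp [hE₁v, hF])
  rw [← sub_add_cancel E ((E (v e) / F.velocity (P.comap (base e)) f) • E₁)]
  exact add_mem h (Submodule.smul_mem _ _ hE₁)

include e in
/-- If the base is flexible with infinitely transitive special automorphism group, then a
suspension is flexible. -/
theorem isFlexible [Algebra.FiniteType ℝ A] (hf : f ≠ 0) (hflex : IsFlexible A)
    (htrans : ∀ m, SAutIsMTransitive A m)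
    (hsurj : (fun x : RealPoints A => x.ev f) '' regularLocus A = Set.univ) : IsFlexible B := by
  obtain ⟨x, hx, hx0, hF⟩ := exists_velocity_ne_zero_of_transitive (htrans 1) hsurj
  obtain ⟨P, rfl, hu, hv⟩ := exists_point e x 1 (x.ev f) (one_mul _)
  have hP : P ∈ regularLocus B := (mem_regularLocus_iff e hf P).mpr ⟨hx, .inl (by simp [hu])⟩
  intro Q hQ
  obtain ⟨g, -, hg⟩ := isMTransitive e hf hflex htrans hsurj 1 (fun _ => P) (fun _ => Q)
    (Function.injective_of_subsingleton _) (Function.injective_of_subsingleton _) (fun _ => hP)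
    fun _ => hQ
  rw [← hg 0]
  exact (isFlexiblePoint e P (hflex _ hx) hx0 hF).smul g

end Suspension

theorem mainTheorem5 (l : ℕ) (A : Fin (l + 1) → Type u)
    [∀ i, CommRing (A i)] [∀ i, Algebra ℝ (A i)]
    [IsDomain (A 0)] [Algebra.FiniteType ℝ (A 0)]
    (hflex : IsFlexible (A 0))
    (hconn : IsConnected (regularLocus (A 0)))
    (htrans : ∀ m : ℕ, SAutIsMTransitive (A 0) m)
    (f : ∀ i : Fin l, A i.castSucc)
    (e : ∀ i : Fin l, A i.succ ≃ₐ[ℝ] Suspension (A i.castSucc) (f i))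
    (hf : ∀ i : Fin l, (fun x : RealPoints (A i.castSucc) => x.ev (f i)) ''
      regularLocus (A i.castSucc) = Set.univ) :
    ∀ i : Fin l, IsFlexible (A i.succ) ∧ ∀ m : ℕ, SAutIsMTransitive (A i.succ) m := by
  have key : ∀ i : Fin (l + 1), IsDomain (A i) ∧ Algebra.FiniteType ℝ (A i) ∧
      IsFlexible (A i) ∧ ∀ m : ℕ, SAutIsMTransitive (A i) m := by
    intro i
    induction i using Fin.induction with
    | zero => exact ⟨inferInstance, inferInstance, hflex, htrans⟩
    | succ i ih =>
      obtain ⟨_, _, hflex, htrans⟩ := ih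
      have hf0 : f i ≠ 0 := by
        intro h0
        obtain ⟨x, -, hx⟩ : (1 : ℝ) ∈ (fun x : RealPoints (A i.castSucc) => x.ev (f i)) ''
          regularLocus (A i.castSucc) := hf i ▸ Set.mem_univ _
        simp [h0] at hx
      have := Suspension.isDomain (e i) hf0
      exact ⟨this, Suspension.finiteType (e i), Suspension.isFlexible (e i) hf0 hflex htrans (hf i),
        Suspension.isMTransitive (e i) hf0 hflex htrans (hf i)⟩
  exact fun i => (key i.succ).2.2
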